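/- Let $\Delta\ge 2$ and let $\alpha_p\ge 0$ for $2\le p\le\Delta$, with $\lambda:=\sum_{2\le p\le\Delta}p(p-1)\alpha_p>1$. For $N\ge1$ let $E$ be the random hyperedge set on $[N]=\{1,\dots,N\}$ in which, for each $2\le p\le\Delta$, every $p$-element subset of $[N]$ is included independently with probability $\min\{1,\alpha_pN/\binom Np\}$. For each $2\le p\le\Delta$ let $\rho_p:\mathbb R\to\mathbb R$ be an odd measurable function and let $(J_e)$ be i.i.d. standard Gaussian variables indexed by the hyperedges, independent of $E$. The diluted mixed $p$-spin Hamiltonian is $$H_J(\sigma)=\sum_{e\in E}\rho_{|e|}(J_e)\prod_{i\in e}\sigma_i,\qquad \sigma\in\{\pm1\}^N .$$ For $t\ge0$ let the perturbed disorder $J(t)$ be either $J_e(t)=e^{-t}J_e+\sqrt{1-e^{-2t}}\,J_e'$ for all $e$ (continuous perturbation), or $J_e(t)=B_eJ_e+(1-B_e)J'_e$ for all $e$ (discrete perturbation), where the $J_e'$ are independent copies of the $J_e$, the $B_e$ are Bernoulli with success probability $e^{-t}$, and all these variables are independent of each other and of $E$. For $\beta\in[0,\infty)$ let $G_{J,\beta}(\sigma)\propto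 e^{\beta H_J(\sigma)}$ be the Gibbs measure, and let $G_{J,\infty}$ be the uniform distribution on the set of maximizers of $H_J$. Given $(E,J,J(t))$, let $\langle\cdot\rangle_t$ be the expectation over $(\sigma,\tau)\sim G_{J,\beta}\otimes G_{J(t),\beta}$ (both Hamiltonians use the same $E$), and let $R(\sigma,\tau)=\frac1N\sum_{i=1}^N\sigma_i\tau_i$. Then there is a constant $C>0$ depending only on $(\alpha_p)_{2\le p\le\Delta}$ such that, for both types of perturbation, all odd measurable $(\rho_p)_{2\le p\le\Delta}$, all $t\ge0$, all $\beta\in[0,\infty]$ and all $N\ge1$, $$\mathbb E\langle R(\sigma,\tau)^2\rangle_t\le\frac{C}{N^{t/(t+2\log\lambda)}},$$ where $\mathbb E$ is the expectation over $E$, $J$ and $J(t)$. -/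

import Mathlib

open MeasureTheory ProbabilityTheory
open scoped ENNReal

namespace DilutedSpin

noncomputable section

/-! ### Spin configurations, hyperedges, Hamiltonian -/

/-- Spin configurations `σ ∈ {±1}^N`. -/
abbrev Config (N : ℕ) : Type := Fin N → ℤˣ

/-- The `i`-th spin as a real number. -/
def spin {N : ℕ} (σ : Config N) (i : Fin N) : ℝ := ((σ i : ℤ) : ℝ)

/-- The potential hyperedges: all vertex sets of cardinality `p` with `2 ≤ p ≤ Δ`. -/
abbrev Hyperedge (N Δ : ℕ) : Type := {e : Finset (Fin N) // 2 ≤ e.card ∧ e.card ≤ Δ}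

/-- The overlap `R(σ,τ) = N⁻¹ ∑ i, σ_i τ_i`. -/
def overlap {N : ℕ} (σ τ : Config N) : ℝ := (1 / (N : ℝ)) * ∑ i, spin σ i * spin τ i

/-- The Hamiltonian `∑_p ∑_{e ∈ E_p} ρ_p(J_e) ∏_{i ∈ e} σ_i`, where the hyperedge set is
`E = {e | X e = true}` and `J` is the disorder. -/
def hamiltonian {N Δ : ℕ} (ρ : ℕ → ℝ → ℝ) (X : Hyperedge N Δ → Bool) (J : Hyperedge N Δ → ℝ)
    (σ : Config N) : ℝ :=
  ∑ e : Hyperedge N Δ with X e = true, ρ e.1.card (J e) * ∏ i ∈ e.1, spin σ i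

/-! ### Gibbs measures at inverse temperature `β ∈ [0,∞]` -/

/-- The ground states: the maximizers of `H`. -/
def groundStates {N : ℕ} (H : Config N → ℝ) : Finset (Config N) :=
  open Classical in Finset.univ.filter fun σ => ∀ σ', H σ' ≤ H σ

/-- The Gibbs weight of `σ`: `exp(β H(σ)) / Z` if `β < ∞`, and the uniform distribution on
the ground states if `β = ∞`. -/
def gibbs {N : ℕ} (β : ℝ≥0∞) (H : Config N → ℝ) (σ : Config N) : ℝ :=
  open Classical in
  if β = ∞ then
    if σ ∈ groundStates H then 1 / ((groundStates H).card : ℝ) else 0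
  else Real.exp (β.toReal * H σ) / ∑ σ', Real.exp (β.toReal * H σ')

/-- The average of `R(σ,τ)²` when `σ` and `τ` are drawn independently from the Gibbs measures
of `H` and `H'`. -/
def gibbsOverlapSq {N : ℕ} (β : ℝ≥0∞) (H H' : Config N → ℝ) : ℝ :=
  ∑ σ, ∑ τ, overlap σ τ ^ 2 * (gibbs β H σ * gibbs β H' τ)

/-! ### The randomness -/

/-- The two types of perturbation of the disorder. -/
inductive Perturbation
  | continuous
  | discrete

/-- The Bernoulli parameter obtained by truncating a real number to `[0,1]`. -/
def toUnit (x : ℝ) : unitInterval := Set.projIcc 0 1 zero_le_one x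

/-- The joint law of `(J, J(t))` on a single hyperedge, where `J, J'` are independent standard
Gaussians and `J(t) = e^{-t} J + √(1 - e^{-2t}) J'` (continuous perturbation), respectively
`J(t) = B J + (1 - B) J'` with `B ∼ Ber(e^{-t})` independent of `(J, J')`
(discrete perturbation). -/
def pairLaw (t : ℝ) : Perturbation → Measure (ℝ × ℝ)
  | .continuous =>
    ((gaussianReal 0 1).prod (gaussianReal 0 1)).map fun x : ℝ × ℝ =>
      (x.1, Real.exp (-t) * x.1 + √(1 - Real.exp (-2 * t)) * x.2)
  | .discrete =>
    (((gaussianReal 0 1).prod (gaussianReal 0 1)).prod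
      (bernoulliMeasure (1 : ℝ) 0 (toUnit (Real.exp (-t))))).map fun x : (ℝ × ℝ) × ℝ =>
        (x.1.1, x.2 * x.1.1 + (1 - x.2) * x.1.2)

/-- The probability (truncated at `1`) that a given `p`-hyperedge is present, `α_p N / C(N,p)`. -/
def edgeProb (α : ℕ → ℝ) (N p : ℕ) : unitInterval :=
  toUnit (α p * (N : ℝ) / (N.choose p : ℝ))

/-- The law of `(X_e)_e` and `((J_e, J_e(t)))_e`: the presence indicators of the potential
hyperedges are independent, the pairs `(J_e, J_e(t))` are i.i.d., and the two families are
independent of each other. -/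
def law (N Δ : ℕ) (α : ℕ → ℝ) (t : ℝ) (κ : Perturbation) :
    Measure ((Hyperedge N Δ → Bool) × (Hyperedge N Δ → ℝ × ℝ)) :=
  (Measure.pi fun e : Hyperedge N Δ => bernoulliMeasure true false (edgeProb α N e.1.card)).prod
    (Measure.pi fun _ : Hyperedge N Δ => pairLaw t κ)

/-- `⟨R(σ,τ)²⟩_t` as a function of the random hypergraph and the pair `(J, J(t))`. -/
def overlapSqAvg {N Δ : ℕ} (ρ : ℕ → ℝ → ℝ) (β : ℝ≥0∞)
    (ω : (Hyperedge N Δ → Bool) × (Hyperedge N Δ → ℝ × ℝ)) : ℝ :=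
  gibbsOverlapSq β (hamiltonian ρ ω.1 fun e => (ω.2 e).1) (hamiltonian ρ ω.1 fun e => (ω.2 e).2)

/-- `λ = ∑_{2 ≤ p ≤ Δ} p (p - 1) α_p`. -/
def branching (Δ : ℕ) (α : ℕ → ℝ) : ℝ := ∑ p ∈ Finset.Icc 2 Δ, (p : ℝ) * ((p : ℝ) - 1) * α p

end

end DilutedSpin

namespace DilutedSpin

noncomputable section

/-! Since `σ` and `τ` are independent under the two Gibbs measures, the averaged squared overlap is
`N⁻²` times the sum over `i, j` of `corr i j` at `J` times `corr i j` at `J(t)`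
(`gibbsOverlapSq_eq`). For a fixed hypergraph, split each correlation into components `oddPart S`,
odd in the couplings in `S` and even in the others. Components with different `S` are orthogonal for
the joint law of `(J, J(t))`, since changing both signs on one hyperedge preserves that law. The
component of `S` contributes at most `e^{-t|S|}` times its squared `L²` norm, and these norms sum to
at most 1 (`OddCorrelationLE.integral_mul_le`).

Flipping the spin at `v` amounts to negating all couplings on hyperedges through `v`, because each
`ρ_p` is odd. Hence for `i ≠ j` only sets `S` of present hyperedges whose odd-degree vertices are
exactly `i` and `j` contribute (`hasOddBoundary_of_oddPart_ne_zero`). If every such `S` has at least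
`k` elements, the pair contributes at most `e^{-tk}`.

The remaining pairs are rare. A smaller `S` contains a trail of length below `k` from `i` that
reaches `j` or returns to a vertex already met (`exists_trail_of_hasOddBoundary`). The expected
number of trails of length `n` is at most `λ^n`, and returning costs a factor of order `n/N`, which
pays for the `N` choices of `j` (`sum_integral_hasShortBoundary_le`). Altogether the average is at
most `e^{-tk} + C λ^{2k}/N`, and `exists_balanced_exponent` chooses `k`.

The analytic point is the factor `e^{-t}` per odd coordinate. It has to survive tensorization, where
integrating out coordinates destroys product structure. `OddCorrelationLE` therefore speaks of
functions merely dominated by a product. -/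

/-- On functions odd in each variable, the measure `μ` on the plane acts as a bilinear form of norm
at most `c` on `L²` of the standard Gaussian. -/
def OddCorrelationLE (μ : Measure (ℝ × ℝ)) (c : ℝ) : Prop :=
  ∀ (I : ℝ × ℝ → ℝ) (A B : ℝ → ℝ), Measurable I → Measurable A → Measurable B →
    (∀ x, 0 ≤ A x) → (∀ x, 0 ≤ B x) → (∃ M, ∀ x, A x ≤ M) → (∃ M, ∀ x, B x ≤ M) →
    (∀ x y, I (-x, y) = -I (x, y)) → (∀ x y, I (x, -y) = -I (x, y)) →
    (∀ x y, |I (x, y)| ≤ A x * B y) →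
    |∫ z, I z ∂μ| ≤ c * ((∫ x, A x ^ 2 ∂gaussianReal 0 1 + ∫ x, B x ^ 2 ∂gaussianReal 0 1) / 2)

lemma integrable_of_abs_le {Ω : Type*} [MeasurableSpace Ω] {μ : Measure Ω} [IsFiniteMeasure μ]
    {f : Ω → ℝ} (hf : Measurable f) {M : ℝ} (h : ∀ x, |f x| ≤ M) : Integrable f μ :=
  Integrable.of_bound hf.aestronglyMeasurable M (Filter.Eventually.of_forall h)

lemma integrable_sq_of_bound {Ω : Type*} [MeasurableSpace Ω] {μ : Measure Ω} [IsFiniteMeasure μ]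
    {f : Ω → ℝ} (hf : Measurable f) {M : ℝ} (h0 : ∀ x, 0 ≤ f x) (h : ∀ x, f x ≤ M) :
    Integrable (fun x => f x ^ 2) μ :=
  integrable_of_abs_le (hf.pow_const 2) (M := M ^ 2) fun x => by
    rw [abs_of_nonneg (sq_nonneg _)]
    exact pow_le_pow_left₀ (h0 x) (h x) 2

lemma abs_integral_le_half_sq {Ω : Type*} [MeasurableSpace Ω] {μ : Measure Ω}
    [IsProbabilityMeasure μ] {I A B : Ω → ℝ} (hA : Integrable (fun x => A x ^ 2) μ)
    (hB : Integrable (fun x => B x ^ 2) μ) (h : ∀ x, |I x| ≤ A x * B x) :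
    |∫ x, I x ∂μ| ≤ (∫ x, A x ^ 2 ∂μ + ∫ x, B x ^ 2 ∂μ) / 2 := by
  rw [← integral_add hA hB, ← integral_div]
  refine (abs_integral_le_integral_abs).trans (integral_mono_of_nonneg
    (Filter.Eventually.of_forall fun x => abs_nonneg _) ((hA.add hB).div_const 2)
    (Filter.Eventually.of_forall fun x => ?_))
  have := h x
  simp only
  nlinarith [sq_nonneg (A x - B x)]

/-! ### Schur's test for the odd part of the Ornstein–Uhlenbeck kernel -/

section Kernel

variable (c : ℝ) (v : NNReal)

/-- The odd part of the Gaussian transition density from `c * x` with variance `v`. -/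
def oddKernel (x y : ℝ) : ℝ := |gaussianPDFReal (c * x) v y - gaussianPDFReal (c * x) v (-y)| / 2

lemma oddKernel_nonneg (x y : ℝ) : 0 ≤ oddKernel c v x y :=
  div_nonneg (abs_nonneg _) zero_le_two

lemma measurable_oddKernel : Measurable (fun z : ℝ × ℝ => oddKernel c v z.1 z.2) := by
  unfold oddKernel gaussianPDFReal
  simp only [← Real.norm_eq_abs]
  fun_prop

lemma gaussianPDFReal_neg_neg (m : ℝ) (y : ℝ) :
    gaussianPDFReal (-m) v (-y) = gaussianPDFReal m v y := by
  simp only [gaussianPDFReal]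
  congr 3
  ring

variable {c v}

/-- Reversibility: with `c² + v = 1` both sides are the joint density of two standard Gaussians with
correlation `c`. -/
lemma gaussianPDFReal_mul_symm (hv : v ≠ 0) (hcv : c ^ 2 + v = 1) (x y : ℝ) :
    gaussianPDFReal 0 1 x * gaussianPDFReal (c * x) v y =
      gaussianPDFReal 0 1 y * gaussianPDFReal (c * y) v x := by
  have hv' : (v : ℝ) ≠ 0 := by exact_mod_cast hv
  have hc : c ^ 2 = 1 - v := by linarith
  simp only [gaussianPDFReal]
  have h : ∀ a b s r : ℝ, a * Real.exp s * (b * Real.exp r) = a * b * Real.exp (s + r) :=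
    fun a b s r => by rw [Real.exp_add]; ring
  rw [h, h]
  congr 2
  push_cast
  field_simp
  ring_nf
  rw [hc]
  ring

lemma gaussianPDFReal_mul_oddKernel_symm (hv : v ≠ 0) (hcv : c ^ 2 + v = 1) (x y : ℝ) :
    gaussianPDFReal 0 1 x * oddKernel c v x y = gaussianPDFReal 0 1 y * oddKernel c v y x := by
  have h1 := gaussianPDFReal_mul_symm hv hcv x y
  have h2 := gaussianPDFReal_mul_symm hv hcv x (-y)
  have h3 : gaussianPDFReal (c * -y) v x = gaussianPDFReal (c * y) v (-x) := by
    rw [← gaussianPDFReal_neg_neg v (c * y) (-x)]; simp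
  have h4 : gaussianPDFReal 0 1 (-y) = gaussianPDFReal 0 1 y := by
    simpa using gaussianPDFReal_neg_neg 1 0 y
  rw [h3, h4] at h2
  have hx := gaussianPDFReal_nonneg 0 1 x
  have hy := gaussianPDFReal_nonneg 0 1 y
  unfold oddKernel
  have h : ∀ a b : ℝ, 0 ≤ a → a * (|b| / 2) = |a * b| / 2 := fun a b ha => by
    rw [abs_mul, abs_of_nonneg ha, mul_div_assoc]
  rw [h _ _ hx, h _ _ hy, mul_sub, mul_sub, h1, h2]

lemma gaussianPDFReal_neg_le (m : ℝ) {y : ℝ} (h : 0 ≤ m * y) :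
    gaussianPDFReal m v (-y) ≤ gaussianPDFReal m v y := by
  simp only [gaussianPDFReal]
  gcongr ?_ * Real.exp (?_ / _)
  nlinarith

lemma integrable_mul_gaussianPDFReal (hv : v ≠ 0) (m : ℝ) :
    Integrable (fun y => y * gaussianPDFReal m v y) := by
  have h : Integrable id (gaussianReal m v) :=
    memLp_one_iff_integrable.1 (memLp_id_gaussianReal' 1 (by simp))
  rw [gaussianReal_of_var_ne_zero m hv] at h
  rw [integrable_withDensity_iff (measurable_gaussianPDF m v)
    (Filter.Eventually.of_forall fun _ => gaussianPDF_lt_top)] at h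
  simpa [toReal_gaussianPDF] using h

lemma integral_mul_gaussianPDFReal (hv : v ≠ 0) (m : ℝ) :
    ∫ y, y * gaussianPDFReal m v y = m := by
  have h := integral_id_gaussianReal (μ := m) (v := v)
  rw [integral_gaussianReal_eq_integral_smul hv] at h
  simpa [mul_comm] using h

/-- The density with mean `c * x` is larger at whichever of `y`, `-y` has the sign of `x`.
Multiplying by `sign x` thus removes both absolute values, and what remains is the Gaussian mean `c
* x`. So `|y|` is a positive eigenfunction with eigenvalue `c`. -/
lemma lintegral_abs_mul_oddKernel (hc : 0 ≤ c) (hv : v ≠ 0) (x : ℝ) :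
    ∫⁻ y, ENNReal.ofReal (|y| * oddKernel c v x y) = ENNReal.ofReal (c * |x|) := by
  set m := c * x with hm
  have hint : Integrable (fun y => (SignType.sign x : ℝ) *
      ((y * gaussianPDFReal m v y + (-y) * gaussianPDFReal m v (-y)) / 2)) :=
    (((integrable_mul_gaussianPDFReal hv m).add
      (integrable_mul_gaussianPDFReal hv m).comp_neg).div_const 2).const_mul _
  have hI : ∫ y, (SignType.sign x : ℝ) *
      ((y * gaussianPDFReal m v y + (-y) * gaussianPDFReal m v (-y)) / 2) = c * |x| := by
    rw [integral_const_mul, integral_div, integral_add (integrable_mul_gaussianPDFReal hv m)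
      (integrable_mul_gaussianPDFReal hv m).comp_neg,
      integral_neg_eq_self (fun y => y * gaussianPDFReal m v y), integral_mul_gaussianPDFReal hv]
    rw [hm, ← sign_mul_self x]
    ring
  have key : ∀ y, (SignType.sign x : ℝ) *
      ((y * gaussianPDFReal m v y + (-y) * gaussianPDFReal m v (-y)) / 2)
        = |y| * oddKernel c v x y := by
    intro y
    unfold oddKernel
    rw [← hm]
    rcases lt_trichotomy x 0 with hx | hx | hx
    · have hs : ((SignType.sign x : SignType) : ℝ) = -1 := by rw [sign_neg hx]; simp
      rw [hs]
      rcases le_total 0 y with hy | hy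
      · have := gaussianPDFReal_neg_le (v := v) m (y := -y)
          (by rw [hm]; nlinarith [mul_nonneg hc (mul_nonneg (neg_nonneg.2 hx.le) hy)])
        rw [neg_neg] at this
        rw [abs_of_nonneg hy, abs_of_nonpos (by linarith)]
        ring
      · have := gaussianPDFReal_neg_le (v := v) m (y := y)
          (by rw [hm]; nlinarith [mul_nonneg hc (mul_nonneg_of_nonpos_of_nonpos hx.le hy)])
        rw [abs_of_nonpos hy, abs_of_nonneg (by linarith)]
        ring
    · subst hx
      have h0 : m = 0 := by simp [hm]
      have : gaussianPDFReal 0 v (-y) = gaussianPDFReal 0 v y := by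
        simpa using gaussianPDFReal_neg_neg v 0 y
      simp [h0, this]
    · have hs : ((SignType.sign x : SignType) : ℝ) = 1 := by rw [sign_pos hx]; simp
      rw [hs]
      rcases le_total 0 y with hy | hy
      · have := gaussianPDFReal_neg_le (v := v) m (y := y)
          (by rw [hm]; positivity)
        rw [abs_of_nonneg hy, abs_of_nonneg (by linarith)]
        ring
      · have := gaussianPDFReal_neg_le (v := v) m (y := -y)
          (by rw [hm]; have := mul_nonneg (mul_nonneg hc hx.le) (neg_nonneg.2 hy); linarith)
        rw [neg_neg] at this
        rw [abs_of_nonpos hy, abs_of_nonpos (by linarith)]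
        ring
  rw [← hI, ofReal_integral_eq_lintegral_ofReal hint]
  · exact lintegral_congr fun y => by rw [key]
  · exact Filter.Eventually.of_forall fun y => by
      simp only [Pi.zero_apply]
      rw [key]; exact mul_nonneg (abs_nonneg _) (oddKernel_nonneg _ _ _ _)

/-- Averaging the integrand over `y` and `-y` leaves only the odd part of the density. -/
lemma enorm_integral_odd_le {φ : ℝ → ℝ} (hφ : Measurable φ) {M : ℝ} (hM : ∀ y, |φ y| ≤ M)
    (hodd : ∀ y, φ (-y) = -φ y) (x : ℝ) :
    ‖∫ y, gaussianPDFReal (c * x) v y * φ y‖ₑ ≤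
      ∫⁻ y, ENNReal.ofReal (|φ y| * oddKernel c v x y) := by
  set q := gaussianPDFReal (c * x) v with hq
  have hint : Integrable (fun y => q y * φ y) :=
    (integrable_gaussianPDFReal (c * x) v).mul_bdd (c := M) hφ.aestronglyMeasurable
      (Filter.Eventually.of_forall hM)
  have h : ∫ y, q y * φ y = ∫ y, φ y * (q y - q (-y)) / 2 := by
    have h1 := integral_neg_eq_self (fun y => q y * φ y) volume
    have h2 : ∫ y, q y * φ y = ((∫ y, q y * φ y) + ∫ y, q (-y) * φ (-y)) / 2 := by
      rw [h1]; ring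
    rw [h2, ← integral_add hint hint.comp_neg, ← integral_div]
    refine integral_congr_ae (Filter.Eventually.of_forall fun y => ?_)
    simp only [hodd]; ring
  rw [h]
  refine (enorm_integral_le_lintegral_enorm _).trans (le_of_eq (lintegral_congr fun y => ?_))
  rw [Real.enorm_eq_ofReal_abs, oddKernel, ← hq, abs_div, abs_mul, abs_two, mul_div_assoc]

/-- Schur's test for the odd kernel, with the eigenfunction `y ↦ |y|`. -/
lemma lintegral_mul_oddKernel_le (hc : 0 ≤ c) (hv : v ≠ 0) (hcv : c ^ 2 + v = 1) {A B : ℝ → ℝ}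
    (hA : Measurable A) (hB : Measurable B) :
    ∫⁻ x, ∫⁻ y, ENNReal.ofReal (gaussianPDFReal 0 1 x * (A x * B y * oddKernel c v x y)) ≤
      (∫⁻ x, ENNReal.ofReal (c / 2 * A x ^ 2 * gaussianPDFReal 0 1 x)) +
      ∫⁻ x, ENNReal.ofReal (c / 2 * B x ^ 2 * gaussianPDFReal 0 1 x) := by
  set g := gaussianPDFReal 0 1 with hg
  have hg0 : ∀ x, 0 ≤ g x := gaussianPDFReal_nonneg 0 1
  have hgm : Measurable g := measurable_gaussianPDFReal 0 1
  have hk := oddKernel_nonneg c v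
  have hkm := measurable_oddKernel c v
  -- The Schur weights: `A x * B y` will be split as `A² |y| / (2|x|) + B² |x| / (2|y|)`.
  -- Integrating the first term in `y` against the kernel brings out the eigenvalue `c`. The second
  -- is treated alike after exchanging the variables.
  let F : (ℝ → ℝ) → ℝ × ℝ → ℝ≥0∞ := fun A z => ENNReal.ofReal (A z.1 ^ 2 / (2 * |z.1|) * g z.1) *
    ENNReal.ofReal (|z.2| * oddKernel c v z.1 z.2)
  have hFm : ∀ A, Measurable A → Measurable (F A) := by
    intro A hA
    have h1 : Measurable fun z : ℝ × ℝ => A z.1 ^ 2 / (2 * |z.1|) * g z.1 := by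
      simp only [← Real.norm_eq_abs]
      fun_prop
    have h2 : Measurable fun z : ℝ × ℝ => |z.2| * oddKernel c v z.1 z.2 := by
      simp only [← Real.norm_eq_abs]
      exact (measurable_norm.comp measurable_snd).mul hkm
    exact h1.ennreal_ofReal.mul h2.ennreal_ofReal
  have hF : ∀ A, Measurable A → ∫⁻ x, ∫⁻ y, F A (x, y) ≤
      ∫⁻ x, ENNReal.ofReal (c / 2 * A x ^ 2 * g x) := by
    intro A hA
    refine lintegral_mono fun x => ?_
    simp only [F]
    rw [lintegral_const_mul', lintegral_abs_mul_oddKernel hc hv, ← ENNReal.ofReal_mul]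
    · refine ENNReal.ofReal_le_ofReal ?_
      rcases eq_or_ne x 0 with rfl | hx
      · simp only [abs_zero, mul_zero]
        exact mul_nonneg (by positivity) (hg0 _)
      · refine le_of_eq ?_
        have : |x| ≠ 0 := abs_ne_zero.2 hx
        field_simp
    · exact mul_nonneg (by positivity) (hg0 _)
    · exact ENNReal.ofReal_ne_top
  have hswap : ∫⁻ x, ∫⁻ y, F B (y, x) = ∫⁻ x, ∫⁻ y, F B (x, y) :=
    (lintegral_lintegral_swap (hFm B hB).aemeasurable).symm
  refine le_trans ?_ (add_le_add (hF A hA) (hF B hB))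
  rw [← hswap, ← lintegral_add_left ((hFm A hA).lintegral_prod_right')]
  refine lintegral_mono_ae ?_
  -- On the axes the weights degenerate to 0 through division by zero, so the pointwise comparison
  -- is only made almost everywhere.
  have hne : ∀ᵐ x : ℝ, x ≠ 0 := by simp [ae_iff]
  filter_upwards [hne] with x hx
  rw [← lintegral_add_left (f := fun y => F A (x, y)) ((hFm A hA).comp measurable_prodMk_left)]
  refine lintegral_mono_ae ?_
  filter_upwards [hne] with y hy
  simp only [F]
  have hx' : 0 < |x| := abs_pos.2 hx
  have hy' : 0 < |y| := abs_pos.2 hy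
  have hgx := hg0 x
  have hgy := hg0 y
  have hkx := hk x y
  have hky := hk y x
  rw [← ENNReal.ofReal_mul (by positivity), ← ENNReal.ofReal_mul (by positivity),
    ← ENNReal.ofReal_add (by positivity) (by positivity)]
  refine ENNReal.ofReal_le_ofReal ?_
  have hsymm := gaussianPDFReal_mul_oddKernel_symm hv hcv x y
  rw [← hg] at hsymm
  have e1 : B y ^ 2 / (2 * |y|) * g y * (|x| * oddKernel c v y x) =
      B y ^ 2 / (2 * |y|) * |x| * (g x * oddKernel c v x y) := by rw [hsymm]; ring
  have e2 : A x ^ 2 / (2 * |x|) * g x * (|y| * oddKernel c v x y) =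
      A x ^ 2 / (2 * |x|) * |y| * (g x * oddKernel c v x y) := by ring
  rw [e1, e2, ← add_mul, mul_left_comm]
  refine mul_le_mul_of_nonneg_right ?_ (by positivity)
  have e3 : A x ^ 2 / (2 * |x|) * |y| + B y ^ 2 / (2 * |y|) * |x| - A x * B y =
      (A x * |y| - B y * |x|) ^ 2 / (2 * |x| * |y|) := by field_simp; ring
  have : 0 ≤ (A x * |y| - B y * |x|) ^ 2 / (2 * |x| * |y|) := by positivity
  linarith

end Kernel

/-! ### The odd correlation bound for the two perturbations -/

/-- Given the first coordinate `x`, the second is Gaussian with mean `c * x` and variance `s²`.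
Oddness in `y` replaces its density by `oddKernel`, to which Schur's test applies. A density exists
because `s ≠ 0`. -/
lemma OddCorrelationLE.continuous {c s : ℝ} (hc : 0 ≤ c) (hs : s ≠ 0) (hcs : c ^ 2 + s ^ 2 = 1) :
    OddCorrelationLE (((gaussianReal 0 1).prod (gaussianReal 0 1)).map fun x : ℝ × ℝ =>
      (x.1, c * x.1 + s * x.2)) c := by
  intro I A B hI hA hB hA0 hB0 ⟨MA, hMA⟩ ⟨MB, hMB⟩ ho1 ho2 hIAB
  set γ := gaussianReal 0 1 with hγ
  have hMI : ∀ z, |I z| ≤ MA * MB := fun z => (hIAB z.1 z.2).trans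
    (mul_le_mul (hMA _) (hMB _) (hB0 _) ((hA0 z.1).trans (hMA _)))
  let v : NNReal := ⟨s ^ 2, sq_nonneg s⟩
  have hv : v ≠ 0 := fun h => hs (by
    have := congrArg NNReal.toReal h
    exact pow_eq_zero_iff (two_ne_zero) |>.1 this)
  have hcv : c ^ 2 + v = 1 := hcs
  have hm : Measurable fun x : ℝ × ℝ => (x.1, c * x.1 + s * x.2) := by fun_prop
  have hinner : ∀ x, ∫ z, I (x, c * x + s * z) ∂γ =
      ∫ y, gaussianPDFReal (c * x) v y * I (x, y) := by
    intro x
    have hmap : γ.map (fun z => c * x + s * z) = gaussianReal (c * x) v := by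
      have h1 : (γ.map (s * ·)).map (c * x + ·) = gaussianReal (c * x) v := by
        rw [hγ, gaussianReal_map_const_mul, gaussianReal_map_const_add]
        simp only [mul_zero, zero_add, mul_one, v]
        rfl
      rw [← h1, Measure.map_map (by fun_prop) (by fun_prop)]
      rfl
    have h2 : Measurable fun y => I (x, y) := hI.comp measurable_prodMk_left
    rw [← integral_map (φ := fun z => c * x + s * z) (f := fun y => I (x, y)) (by fun_prop)
      h2.aestronglyMeasurable, hmap, integral_gaussianReal_eq_integral_smul hv]
    rfl
  have hlin : ∀ f : ℝ → ℝ≥0∞, Measurable f →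
      ∫⁻ x, f x ∂γ = ∫⁻ x, ENNReal.ofReal (gaussianPDFReal 0 1 x) * f x := by
    intro f hf
    rw [hγ, gaussianReal_of_var_ne_zero 0 one_ne_zero,
      lintegral_withDensity_eq_lintegral_mul _ (measurable_gaussianPDF 0 1) hf]
    rfl
  have hsq : ∀ {A : ℝ → ℝ}, Measurable A → (∀ x, 0 ≤ A x) → (∀ M, (∀ x, A x ≤ M) →
      ∫⁻ x, ENNReal.ofReal (c / 2 * A x ^ 2 * gaussianPDFReal 0 1 x) =
        ENNReal.ofReal (c / 2 * ∫ x, A x ^ 2 ∂γ)) := by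
    intro A hA hA0 M hM
    have hi : Integrable (fun x => c / 2 * A x ^ 2) γ :=
      (integrable_sq_of_bound hA hA0 hM).const_mul _
    rw [← integral_const_mul, ofReal_integral_eq_lintegral_ofReal hi
      (Filter.Eventually.of_forall fun x => by simp only [Pi.zero_apply]; positivity),
      hlin (fun x => ENNReal.ofReal (c / 2 * A x ^ 2)) (by fun_prop)]
    refine lintegral_congr fun x => ?_
    rw [mul_comm, ENNReal.ofReal_mul (gaussianPDFReal_nonneg 0 1 x)]
  have hIm : Integrable (fun x : ℝ × ℝ => I (x.1, c * x.1 + s * x.2)) (γ.prod γ) :=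
    integrable_of_abs_le (hI.comp hm) fun _ => hMI _
  rw [integral_map hm.aemeasurable hI.aestronglyMeasurable, integral_prod _ hIm]
  have hbound : ‖∫ x, ∫ z, I (x, c * x + s * z) ∂γ ∂γ‖ₑ ≤
      ENNReal.ofReal (c * ((∫ x, A x ^ 2 ∂γ + ∫ x, B x ^ 2 ∂γ) / 2)) := by
    have hA2 : 0 ≤ ∫ x, A x ^ 2 ∂γ := integral_nonneg fun x => sq_nonneg _
    have hB2 : 0 ≤ ∫ x, B x ^ 2 ∂γ := integral_nonneg fun x => sq_nonneg _
    have hsplit : ENNReal.ofReal (c * ((∫ x, A x ^ 2 ∂γ + ∫ x, B x ^ 2 ∂γ) / 2)) =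
        ENNReal.ofReal (c / 2 * ∫ x, A x ^ 2 ∂γ) + ENNReal.ofReal (c / 2 * ∫ x, B x ^ 2 ∂γ) := by
      rw [← ENNReal.ofReal_add (by positivity) (by positivity)]
      congr 1; ring
    rw [hsplit, ← hsq hA hA0 MA hMA, ← hsq hB hB0 MB hMB]
    refine le_trans ?_ (lintegral_mul_oddKernel_le hc hv hcv hA hB)
    refine (enorm_integral_le_lintegral_enorm _).trans ?_
    have hmeas : Measurable fun x => ∫ z, I (x, c * x + s * z) ∂γ :=
      (StronglyMeasurable.integral_prod_right' (f := fun z : ℝ × ℝ => I (z.1, c * z.1 + s * z.2))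
        (hI.comp hm).stronglyMeasurable).measurable
    rw [hlin _ hmeas.enorm]
    refine lintegral_mono fun x => ?_
    simp only
    rw [hinner]
    have h2 : Measurable fun y => I (x, y) := hI.comp measurable_prodMk_left
    refine (mul_le_mul_right (enorm_integral_odd_le h2 (fun y => hMI (x, y)) (ho2 x) x) _).trans ?_
    rw [← lintegral_const_mul' _ _ ENNReal.ofReal_ne_top]
    refine lintegral_mono fun y => ?_
    simp only
    rw [← ENNReal.ofReal_mul (gaussianPDFReal_nonneg 0 1 x)]
    refine ENNReal.ofReal_le_ofReal (mul_le_mul_of_nonneg_left (mul_le_mul_of_nonneg_right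
      (hIAB x y) (oddKernel_nonneg _ _ _ _)) (gaussianPDFReal_nonneg 0 1 x))
  rw [Real.enorm_eq_ofReal_abs] at hbound
  refine (ENNReal.ofReal_le_ofReal_iff ?_).1 hbound
  have hA2 : 0 ≤ ∫ x, A x ^ 2 ∂γ := integral_nonneg fun x => sq_nonneg _
  have hB2 : 0 ≤ ∫ x, B x ^ 2 ∂γ := integral_nonneg fun x => sq_nonneg _
  positivity

/-- On the diagonal the correlation bound is the Cauchy–Schwarz inequality. -/
lemma OddCorrelationLE.diagonal :
    OddCorrelationLE ((gaussianReal 0 1).map fun x : ℝ => (x, x)) 1 := by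
  intro I A B hI hA hB hA0 hB0 ⟨MA, hMA⟩ ⟨MB, hMB⟩ ho1 ho2 hIAB
  rw [integral_map (by fun_prop) hI.aestronglyMeasurable, one_mul]
  exact abs_integral_le_half_sq (integrable_sq_of_bound hA hA0 hMA)
    (integrable_sq_of_bound hB hB0 hMB) fun x => hIAB x x

/-- With probability `q` the two coordinates agree and the diagonal bound applies. Otherwise they
are independent and oddness makes the integral vanish. -/
lemma OddCorrelationLE.discrete (q : unitInterval) :
    OddCorrelationLE ((((gaussianReal 0 1).prod (gaussianReal 0 1)).prod
      (bernoulliMeasure (1 : ℝ) 0 q)).map fun x : (ℝ × ℝ) × ℝ =>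
        (x.1.1, x.2 * x.1.1 + (1 - x.2) * x.1.2)) q := by
  intro I A B hI hA hB hA0 hB0 ⟨MA, hMA⟩ ⟨MB, hMB⟩ ho1 ho2 hIAB
  have hMI : ∀ z, |I z| ≤ MA * MB := fun z => (hIAB z.1 z.2).trans
    (mul_le_mul (hMA _) (hMB _) (hB0 _) ((hA0 z.1).trans (hMA _)))
  set γ := gaussianReal 0 1 with hγ
  have hm : Measurable fun x : (ℝ × ℝ) × ℝ => (x.1.1, x.2 * x.1.1 + (1 - x.2) * x.1.2) := by
    fun_prop
  have hIm : Integrable (fun x : (ℝ × ℝ) × ℝ => I (x.1.1, x.2 * x.1.1 + (1 - x.2) * x.1.2))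
      ((γ.prod γ).prod (bernoulliMeasure (1 : ℝ) 0 q)) :=
    integrable_of_abs_le (hI.comp hm) fun _ => hMI _
  rw [integral_map hm.aemeasurable hI.aestronglyMeasurable, integral_prod_symm _ hIm,
    integral_bernoulliMeasure]
  have h1 : ∫ x : ℝ × ℝ, I (x.1, 1 * x.1 + (1 - 1) * x.2) ∂γ.prod γ = ∫ x, I (x, x) ∂γ := by
    simp only [one_mul, sub_self, zero_mul, add_zero]
    have := integral_fun_fst (μ := γ) (ν := γ) (fun x => I (x, x))
    simpa using this
  have h0 : ∫ x : ℝ × ℝ, I (x.1, 0 * x.1 + (1 - 0) * x.2) ∂γ.prod γ = 0 := by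
    simp only [zero_mul, sub_zero, one_mul, zero_add]
    have hmp : MeasurePreserving (fun x : ℝ => -x) γ γ := ⟨measurable_neg, by
      rw [hγ, gaussianReal_map_neg, neg_zero]⟩
    have hp := hmp.prod (MeasurePreserving.id γ)
    have h2 : ∫ z, I z ∂γ.prod γ = ∫ z, I (Prod.map (fun x => -x) id z) ∂γ.prod γ := by
      conv_lhs => rw [← hp.map_eq]
      exact integral_map hp.measurable.aemeasurable hI.aestronglyMeasurable
    simp only [Prod.map, id, ho1] at h2
    rw [integral_neg] at h2
    linarith
  rw [h1, h0]
  simp only [smul_eq_mul, mul_zero, add_zero]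
  have hq := q.2.1
  rw [abs_mul, abs_of_nonneg hq]
  exact mul_le_mul_of_nonneg_left (abs_integral_le_half_sq (integrable_sq_of_bound hA hA0 hMA)
    (integrable_sq_of_bound hB hB0 hMB) fun x => hIAB x x) hq

lemma coe_toUnit {x : ℝ} (h0 : 0 ≤ x) (h1 : x ≤ 1) : (toUnit x : ℝ) = x := by
  simp [toUnit, Set.coe_projIcc, h0, h1]

lemma oddCorrelationLE_pairLaw {t : ℝ} (ht : 0 ≤ t) (κ : Perturbation) :
    OddCorrelationLE (pairLaw t κ) (Real.exp (-t)) := by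
  cases κ with
  | discrete =>
    have := OddCorrelationLE.discrete (toUnit (Real.exp (-t)))
    rwa [coe_toUnit (Real.exp_pos _).le (Real.exp_le_one_iff.2 (by linarith))] at this
  | continuous =>
    have he : Real.exp (-2 * t) = Real.exp (-t) ^ 2 := by
      rw [← Real.exp_nat_mul]; congr 1; push_cast; ring
    -- At `t = 0` the conditional law is a point mass without density, so this case is taken from
    -- the diagonal bound.
    rcases ht.eq_or_lt with rfl | ht
    · have h := OddCorrelationLE.diagonal
      have h2 : pairLaw 0 .continuous = (gaussianReal 0 1).map fun x : ℝ => (x, x) := by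
        simp only [pairLaw, neg_zero, Real.exp_zero, mul_zero, sub_self, Real.sqrt_zero, zero_mul,
          add_zero, one_mul]
        have : (fun x : ℝ × ℝ => (x.1, x.1)) = (fun x : ℝ => (x, x)) ∘ Prod.fst := rfl
        rw [this, ← Measure.map_map (by fun_prop) (by fun_prop), Measure.map_fst_prod]
        simp
      rw [h2]
      simpa using h
    · have hlt : Real.exp (-2 * t) < 1 := by
        rw [← Real.exp_zero]; exact Real.exp_lt_exp.2 (by linarith)
      refine OddCorrelationLE.continuous (Real.exp_pos _).le
        (Real.sqrt_pos.2 (by linarith)).ne' ?_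
      rw [Real.sq_sqrt (by linarith), he]
      ring

/-! ### Tensorization of the odd correlation bound -/

lemma measurable_finCons {α : Type*} [MeasurableSpace α] {n : ℕ} :
    Measurable (fun z : α × (Fin n → α) => (Fin.cons z.1 z.2 : Fin (n + 1) → α)) := by
  refine measurable_pi_iff.2 fun i => ?_
  refine Fin.cases ?_ (fun j => ?_) i
  · simpa using measurable_fst
  · simp only [Fin.cons_succ]
    exact (measurable_pi_apply j).comp measurable_snd

lemma integral_pi_fin_succ {α : Type*} [MeasurableSpace α] {n : ℕ} (ν : Measure α)
    [IsProbabilityMeasure ν] {F : (Fin (n + 1) → α) → ℝ}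
    (hF : Measurable F) {M : ℝ} (hM : ∀ x, |F x| ≤ M) :
    ∫ x, F x ∂(Measure.pi fun _ => ν) =
      ∫ a, ∫ x, F (Fin.cons a x) ∂(Measure.pi fun _ : Fin n => ν) ∂ν := by
  have h := (measurePreserving_piFinSuccAbove (fun _ : Fin (n + 1) => ν) 0).symm
  rw [← h.integral_comp' (g := F)]
  have h2 : ∀ z : α × (Fin n → α),
      (MeasurableEquiv.piFinSuccAbove (fun _ : Fin (n + 1) => α) 0).symm z = Fin.cons z.1 z.2 := by
    intro z
    simp [MeasurableEquiv.piFinSuccAbove, Fin.insertNthEquiv]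
  simp_rw [h2]
  exact integral_prod _ (integrable_of_abs_le (hF.comp measurable_finCons) fun _ => hM _)

/-- Optimizing over `θ` turns the arithmetic mean into the geometric one. The optimum `θ² = √b/√a`
may degenerate when `a` or `b` vanishes, so it is regularized by `ε`, which then tends to 0. -/
lemma le_mul_sqrt_of_forall_scaling {m w a b : ℝ} (hw : 0 ≤ w) (ha : 0 ≤ a) (hb : 0 ≤ b)
    (h : ∀ θ : ℝ, 0 < θ → m ≤ w * ((θ ^ 2 * a + (θ⁻¹) ^ 2 * b) / 2)) : m ≤ w * (√a * √b) := by
  have key : ∀ ε : ℝ, 0 < ε → m ≤ w * (√a * √b + ε * (√a + √b) / 2) := by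
    intro ε hε
    have hsa := Real.sqrt_nonneg a
    have hsb := Real.sqrt_nonneg b
    refine (h (√((√b + ε) / (√a + ε))) (by positivity)).trans
      (mul_le_mul_of_nonneg_left ?_ hw)
    rw [inv_pow, Real.sq_sqrt (by positivity), inv_div]
    have e1 : (√b + ε) / (√a + ε) * a ≤ (√b + ε) * √a := by
      rw [div_mul_eq_mul_div, div_le_iff₀ (by positivity), mul_assoc]
      refine mul_le_mul_of_nonneg_left ?_ (by positivity)
      nlinarith [Real.mul_self_sqrt ha]
    have e2 : (√a + ε) / (√b + ε) * b ≤ (√a + ε) * √b := by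
      rw [div_mul_eq_mul_div, div_le_iff₀ (by positivity), mul_assoc]
      refine mul_le_mul_of_nonneg_left ?_ (by positivity)
      nlinarith [Real.mul_self_sqrt hb]
    linarith
  have hcont : Filter.Tendsto (fun ε : ℝ => w * (√a * √b + ε * (√a + √b) / 2))
      (nhdsWithin 0 (Set.Ioi 0)) (nhds (w * (√a * √b + 0 * (√a + √b) / 2))) :=
    (Continuous.tendsto (by fun_prop) 0).mono_left nhdsWithin_le_nhds
  have := ge_of_tendsto hcont (Filter.eventually_of_mem self_mem_nhdsWithin key)
  simpa using this

section Tensor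

variable {μ : Measure (ℝ × ℝ)} [IsProbabilityMeasure μ] {c : ℝ}

/-- This handles a coordinate without parity: it contributes the factor 1, and only the marginals of
`μ` matter. -/
lemma abs_integral_pair_le {Ω : Type*} [MeasurableSpace Ω] {γ : Measure Ω} {μ : Measure (Ω × Ω)}
    [IsProbabilityMeasure μ] [IsProbabilityMeasure γ]
    (h1 : MeasurePreserving Prod.fst μ γ) (h2 : MeasurePreserving Prod.snd μ γ)
    {I : Ω × Ω → ℝ} {A B : Ω → ℝ} (hA : Measurable A) (hB : Measurable B)
    {MA MB : ℝ} (hMA : ∀ x, |A x| ≤ MA) (hMB : ∀ x, |B x| ≤ MB)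
    (h : ∀ x y, |I (x, y)| ≤ |A x * B y|) :
    |∫ z, I z ∂μ| ≤ (∫ x, A x ^ 2 ∂γ + ∫ x, B x ^ 2 ∂γ) / 2 := by
  have hi : ∀ {A : Ω → ℝ} {M : ℝ} {g : Ω × Ω → Ω}, Measurable A → (∀ x, |A x| ≤ M) →
      MeasurePreserving g μ γ → Integrable (fun z => |A (g z)| ^ 2) μ ∧
        ∫ z, |A (g z)| ^ 2 ∂μ = ∫ x, A x ^ 2 ∂γ := by
    intro A M g hA hM hg
    simp only [sq_abs]
    refine ⟨integrable_of_abs_le (M := M ^ 2) ((hA.comp hg.measurable).pow_const 2) fun z => ?_, ?_⟩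
    · rw [abs_pow]
      exact pow_le_pow_left₀ (abs_nonneg _) (hM _) 2
    · rw [← hg.map_eq, integral_map hg.measurable.aemeasurable
        (hA.pow_const 2).aestronglyMeasurable]
  have hA' := hi hA hMA h1
  have hB' := hi hB hMB h2
  rw [← hA'.2, ← hB'.2]
  exact abs_integral_le_half_sq hA'.1 hB'.1 fun z => by
    rw [← abs_mul]; exact h z.1 z.2

/-- Induction on the number of coordinates. Integrating out all but the first leaves a function `I
(a, b)` that inherits oddness but is no product. The induction hypothesis, with the scaling trick,
bounds it by the product of the norms of the sections of `u` at `a` and of `v` at `b`. This is the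
domination that the hypothesis on `μ` asks for. -/
theorem OddCorrelationLE.pi_fin (hμ : OddCorrelationLE μ c) (hc : 0 ≤ c)
    (h1 : MeasurePreserving Prod.fst μ (gaussianReal 0 1))
    (h2 : MeasurePreserving Prod.snd μ (gaussianReal 0 1)) :
    ∀ (n : ℕ) (P : Fin n → Prop) [DecidablePred P] (u v : (Fin n → ℝ) → ℝ),
      Measurable u → Measurable v → (∃ M, ∀ x, |u x| ≤ M) → (∃ M, ∀ x, |v x| ≤ M) →
      (∀ e, P e → ∀ x, u (Function.update x e (-x e)) = -u x) →
      (∀ e, P e → ∀ x, v (Function.update x e (-x e)) = -v x) →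
      |∫ z, u (fun e => (z e).1) * v (fun e => (z e).2) ∂(Measure.pi fun _ : Fin n => μ)| ≤
        (∏ e, if P e then c else 1) *
          ((∫ x, u x ^ 2 ∂(Measure.pi fun _ : Fin n => gaussianReal 0 1) +
            ∫ x, v x ^ 2 ∂(Measure.pi fun _ : Fin n => gaussianReal 0 1)) / 2) := by
  intro n
  induction n with
  | zero =>
    intro P _ u v hu hv ⟨Mu, hMu⟩ ⟨Mv, hMv⟩ _ _
    have hx : ∀ x : Fin 0 → ℝ, x = 0 := fun x => Subsingleton.elim _ _
    have e1 : ∀ z : Fin 0 → ℝ × ℝ, u (fun e => (z e).1) * v (fun e => (z e).2) = u 0 * v 0 :=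
      fun z => by rw [hx fun e => (z e).1, hx fun e => (z e).2]
    have e2 : ∀ x, u x ^ 2 = u 0 ^ 2 := fun x => by rw [hx x]
    have e3 : ∀ x, v x ^ 2 = v 0 ^ 2 := fun x => by rw [hx x]
    simp only [e1, e2, e3, integral_const, probReal_univ, smul_eq_mul, one_mul,
      Finset.univ_eq_empty, Finset.prod_empty]
    rw [abs_le]
    constructor <;> nlinarith [sq_nonneg (u 0 - v 0), sq_nonneg (u 0 + v 0)]
  | succ n ih =>
    intro P _ u v hu hv ⟨Mu, hMu⟩ ⟨Mv, hMv⟩ hou hov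
    set γ := gaussianReal 0 1 with hγ
    set w : ℝ := ∏ e : Fin n, if P e.succ then c else 1 with hw
    have hw0 : 0 ≤ w := Finset.prod_nonneg fun e _ => by split_ifs <;> linarith
    have hMu0 : 0 ≤ Mu := (abs_nonneg _).trans (hMu 0)
    have hMv0 : 0 ≤ Mv := (abs_nonneg _).trans (hMv 0)
    let I : ℝ × ℝ → ℝ := fun p => ∫ z, u (Fin.cons p.1 fun e => (z e).1) *
      v (Fin.cons p.2 fun e => (z e).2) ∂(Measure.pi fun _ : Fin n => μ)
    let A : ((Fin (n + 1) → ℝ) → ℝ) → ℝ → ℝ := fun u a =>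
      √(∫ x, u (Fin.cons a x) ^ 2 ∂(Measure.pi fun _ : Fin n => γ))
    have hcons : ∀ {f : (Fin (n + 1) → ℝ) → ℝ}, Measurable f → ∀ a,
        Measurable fun x : Fin n → ℝ => f (Fin.cons a x) := fun hf a =>
      (hf.comp measurable_finCons).comp measurable_prodMk_left
    have hAm : ∀ {f}, Measurable f → Measurable (A f) := fun {f} hf =>
      (StronglyMeasurable.integral_prod_right' (f := fun z : ℝ × (Fin n → ℝ) =>
        f (Fin.cons z.1 z.2) ^ 2)
        ((hf.comp measurable_finCons).pow_const 2).stronglyMeasurable).measurable.sqrt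
    have hsqM : ∀ {f : (Fin (n + 1) → ℝ) → ℝ} {M}, (∀ x, |f x| ≤ M) → ∀ x, |f x ^ 2| ≤ M ^ 2 :=
      fun hM x => by rw [abs_pow]; exact pow_le_pow_left₀ (abs_nonneg _) (hM x) 2
    have hAb : ∀ {f M}, Measurable f → 0 ≤ M → (∀ x, |f x| ≤ M) → ∀ a, |A f a| ≤ M := by
      intro f M hf hM0 hM a
      rw [abs_of_nonneg (Real.sqrt_nonneg _)]
      refine Real.sqrt_le_iff.2 ⟨hM0, ?_⟩
      refine (integral_mono (integrable_of_abs_le ((hcons hf a).pow_const 2) fun x => hsqM hM _)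
        (integrable_const (M ^ 2)) fun x => le_of_abs_le (hsqM hM _)).trans ?_
      simp
    have hA2 : ∀ {f M}, Measurable f → (∀ x, |f x| ≤ M) →
        ∫ a, A f a ^ 2 ∂γ = ∫ x, f x ^ 2 ∂(Measure.pi fun _ : Fin (n + 1) => γ) := by
      intro f M hf hM
      rw [integral_pi_fin_succ γ (hf.pow_const 2) (hsqM hM)]
      refine integral_congr_ae (Filter.Eventually.of_forall fun a => ?_)
      exact Real.sq_sqrt (integral_nonneg fun x => sq_nonneg _)
    have hfst : Measurable fun z : Fin (n + 1) → ℝ × ℝ => fun e => (z e).1 :=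
      measurable_pi_iff.2 fun e => (measurable_pi_apply e).fst
    have hsnd : Measurable fun z : Fin (n + 1) → ℝ × ℝ => fun e => (z e).2 :=
      measurable_pi_iff.2 fun e => (measurable_pi_apply e).snd
    have hpf : ∀ (p : ℝ × ℝ) (z : Fin n → ℝ × ℝ),
        (fun e => ((Fin.cons p z : Fin (n + 1) → ℝ × ℝ) e).1) = Fin.cons p.1 fun e => (z e).1 :=
      fun p z => funext fun e => Fin.cases rfl (fun _ => rfl) e
    have hps : ∀ (p : ℝ × ℝ) (z : Fin n → ℝ × ℝ),
        (fun e => ((Fin.cons p z : Fin (n + 1) → ℝ × ℝ) e).2) = Fin.cons p.2 fun e => (z e).2 :=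
      fun p z => funext fun e => Fin.cases rfl (fun _ => rfl) e
    have hFm : Measurable fun z : Fin (n + 1) → ℝ × ℝ =>
        u (fun e => (z e).1) * v (fun e => (z e).2) := (hu.comp hfst).mul (hv.comp hsnd)
    have hFb : ∀ z : Fin (n + 1) → ℝ × ℝ,
        |u (fun e => (z e).1) * v (fun e => (z e).2)| ≤ Mu * Mv := fun z => by
      rw [abs_mul]; exact mul_le_mul (hMu _) (hMv _) (abs_nonneg _) hMu0
    have hI : ∫ z, u (fun e => (z e).1) * v (fun e => (z e).2)
        ∂(Measure.pi fun _ : Fin (n + 1) => μ) = ∫ p, I p ∂μ := by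
      rw [integral_pi_fin_succ μ hFm hFb]
      simp only [hpf, hps, I]
    have hIm : Measurable I := by
      have := (StronglyMeasurable.integral_prod_right' (f := fun z : (ℝ × ℝ) × (Fin n → ℝ × ℝ) =>
        (fun z : Fin (n + 1) → ℝ × ℝ => u (fun e => (z e).1) * v (fun e => (z e).2))
          (Fin.cons z.1 z.2)) (hFm.comp measurable_finCons).stronglyMeasurable
          (ν := Measure.pi fun _ : Fin n => μ)).measurable
      simpa only [hpf, hps] using this
    have hupd : ∀ (a : ℝ) (x : Fin n → ℝ) (e : Fin n),
        (Fin.cons a (Function.update x e (-x e)) : Fin (n + 1) → ℝ) =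
          Function.update (Fin.cons a x : Fin (n + 1) → ℝ) e.succ
            (-(Fin.cons a x : Fin (n + 1) → ℝ) e.succ) := fun a x e => by
      rw [Fin.cons_succ, Fin.cons_update]
    have hupd0 : ∀ (a : ℝ) (x : Fin n → ℝ), (Fin.cons (-a) x : Fin (n + 1) → ℝ) =
          Function.update (Fin.cons a x : Fin (n + 1) → ℝ) 0
            (-(Fin.cons a x : Fin (n + 1) → ℝ) 0) := fun a x => by
      rw [Fin.cons_zero, Fin.update_cons_zero]
    have hIAB : ∀ a b, |I (a, b)| ≤ w * (A u a * A v b) := by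
      intro a b
      refine le_mul_sqrt_of_forall_scaling hw0 (integral_nonneg fun x => sq_nonneg _)
        (integral_nonneg fun x => sq_nonneg _) fun θ hθ => ?_
      have := ih (fun e => P e.succ) (fun x => θ * u (Fin.cons a x))
        (fun x => θ⁻¹ * v (Fin.cons b x)) ((hcons hu a).const_mul _) ((hcons hv b).const_mul _)
        ⟨θ * Mu, fun x => by
          rw [abs_mul, abs_of_pos hθ]; exact mul_le_mul_of_nonneg_left (hMu _) hθ.le⟩
        ⟨θ⁻¹ * Mv, fun x => by
          rw [abs_mul, abs_of_pos (inv_pos.2 hθ)]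
          exact mul_le_mul_of_nonneg_left (hMv _) (inv_pos.2 hθ).le⟩
        (fun e he x => by rw [hupd, hou _ he, mul_neg]) (fun e he x => by
          rw [hupd, hov _ he, mul_neg])
      simp only [mul_pow, integral_const_mul] at this
      refine le_trans (le_of_eq ?_) this
      simp only [I]
      congr 1
      refine integral_congr_ae (Filter.Eventually.of_forall fun z => ?_)
      simp only
      field_simp
    rw [hI, Fin.prod_univ_succ, ← hw, ← hA2 hu hMu, ← hA2 hv hMv]
    have hA0 : ∀ f a, 0 ≤ A f a := fun f a => Real.sqrt_nonneg _
    have hsw : √w * √w = w := Real.mul_self_sqrt hw0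
    have hint : ∀ f, ∫ x, (√w * A f x) ^ 2 ∂γ = w * ∫ x, A f x ^ 2 ∂γ := fun f => by
      simp only [mul_pow, Real.sq_sqrt hw0, integral_const_mul]
    have hAle : ∀ {f M}, Measurable f → 0 ≤ M → (∀ x, |f x| ≤ M) → ∀ a, |√w * A f a| ≤ √w * M :=
      fun hf hM0 hM a => by
        rw [abs_mul, abs_of_nonneg (Real.sqrt_nonneg w)]
        exact mul_le_mul_of_nonneg_left (hAb hf hM0 hM a) (Real.sqrt_nonneg w)
    -- The factor `w` is shared equally between the two dominating functions, so that it reappears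
    -- once in each squared norm.
    have hIAB' : ∀ a b, |I (a, b)| ≤ (√w * A u a) * (√w * A v b) := fun a b => by
      refine (hIAB a b).trans (le_of_eq ?_)
      rw [mul_mul_mul_comm, hsw]
    split_ifs with hP
    · have := hμ I (fun a => √w * A u a) (fun b => √w * A v b) hIm ((hAm hu).const_mul _)
        ((hAm hv).const_mul _) (fun a => mul_nonneg (Real.sqrt_nonneg _) (hA0 _ _))
        (fun a => mul_nonneg (Real.sqrt_nonneg _) (hA0 _ _))
        ⟨_, fun a => le_of_abs_le (hAle hu hMu0 hMu a)⟩
        ⟨_, fun a => le_of_abs_le (hAle hv hMv0 hMv a)⟩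
        (fun x y => by
          simp only [I, hupd0, hou 0 hP, neg_mul, integral_neg])
        (fun x y => by
          simp only [I, hupd0, hov 0 hP, mul_neg, integral_neg]) hIAB'
      rw [hint, hint] at this
      refine this.trans (le_of_eq ?_)
      ring
    · have := abs_integral_pair_le h1 h2 (I := I) ((hAm hu).const_mul √w) ((hAm hv).const_mul √w)
        (hAle hu hMu0 hMu) (hAle hv hMv0 hMv)
        (fun x y => (hIAB' x y).trans (le_abs_self _))
      rw [hint, hint] at this
      refine this.trans (le_of_eq ?_)
      ring

theorem OddCorrelationLE.pi {ι : Type*} [Fintype ι] [DecidableEq ι] (hμ : OddCorrelationLE μ c)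
    (hc : 0 ≤ c) (h1 : MeasurePreserving Prod.fst μ (gaussianReal 0 1))
    (h2 : MeasurePreserving Prod.snd μ (gaussianReal 0 1)) (S : Finset ι) {u : (ι → ℝ) → ℝ}
    (hu : Measurable u) {M : ℝ} (hM : ∀ x, |u x| ≤ M)
    (hou : ∀ e ∈ S, ∀ x, u (Function.update x e (-x e)) = -u x) :
    |∫ z, u (fun e => (z e).1) * u (fun e => (z e).2) ∂(Measure.pi fun _ : ι => μ)| ≤
      c ^ S.card * ∫ x, u x ^ 2 ∂(Measure.pi fun _ : ι => gaussianReal 0 1) := by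
  set φ : Fin (Fintype.card ι) ≃ ι := (Fintype.equivFin ι).symm with hφ
  have hre : ∀ {α : Type} [MeasurableSpace α] (ν : Measure α) [IsProbabilityMeasure ν]
      (F : (ι → α) → ℝ), ∫ x, F x ∂(Measure.pi fun _ : ι => ν) =
        ∫ x, F (fun e => x (φ.symm e)) ∂(Measure.pi fun _ : Fin (Fintype.card ι) => ν) := by
    intro α _ ν _ F
    have h := measurePreserving_piCongrLeft (fun _ : ι => ν) φ
    rw [← h.integral_comp' (g := F)]
    refine integral_congr_ae (Filter.Eventually.of_forall fun x => ?_)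
    simp only
    congr 1
    funext e
    obtain ⟨i, rfl⟩ := φ.surjective e
    rw [MeasurableEquiv.piCongrLeft_apply_apply]
    simp
  rw [hre, hre]
  have hm : Measurable fun x : Fin (Fintype.card ι) → ℝ => fun e => x (φ.symm e) :=
    measurable_pi_iff.2 fun e => measurable_pi_apply _
  have hodd : ∀ i, φ i ∈ S → ∀ x : Fin (Fintype.card ι) → ℝ,
      u (fun e => Function.update x i (-x i) (φ.symm e)) = -u (fun e => x (φ.symm e)) := by
    intro i hi x
    have := hou _ hi (fun e => x (φ.symm e))
    rw [← this]
    congr 1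
    funext e
    by_cases he : e = φ i
    · subst he; simp
    · have : φ.symm e ≠ i := fun h => he (by rw [← h]; simp)
      simp [he, this]
  have := OddCorrelationLE.pi_fin hμ hc h1 h2 (Fintype.card ι) (fun i => φ i ∈ S)
    (fun x => u fun e => x (φ.symm e)) (fun x => u fun e => x (φ.symm e))
    (hu.comp hm) (hu.comp hm) ⟨M, fun x => hM _⟩ ⟨M, fun x => hM _⟩ hodd hodd
  refine this.trans (le_of_eq ?_)
  have hprod : (∏ i, if φ i ∈ S then c else 1) = c ^ S.card := by
    rw [Equiv.prod_comp φ (fun e => if e ∈ S then c else 1)]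
    simp
  rw [hprod]
  ring

end Tensor

/-! ### Decomposition of a function by its parity in each coordinate -/

section Parity

variable {ι : Type*}

/-- Multiply the coordinates of `J` by the signs `ε`. -/
def signFlip (ε : ι → ℤˣ) (J : ι → ℝ) : ι → ℝ := fun e => ((ε e : ℤ) : ℝ) * J e

/-- The Walsh character `∏ e ∈ S, ε_e`. -/
def walsh (S : Finset ι) (ε : ι → ℤˣ) : ℝ := ∏ e ∈ S, ((ε e : ℤ) : ℝ)

lemma intCast_units_mul_self (a : ℤˣ) : ((a : ℤ) : ℝ) * ((a : ℤ) : ℝ) = 1 := by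
  rcases Int.units_eq_one_or a with rfl | rfl <;> simp

lemma signFlip_mul (ε η : ι → ℤˣ) (J : ι → ℝ) : signFlip (ε * η) J = signFlip ε (signFlip η J) := by
  funext e; simp [signFlip, mul_assoc]

lemma walsh_mul (S : Finset ι) (ε η : ι → ℤˣ) : walsh S (ε * η) = walsh S ε * walsh S η := by
  simp [walsh, Finset.prod_mul_distrib]

lemma walsh_mul_self (S : Finset ι) (ε : ι → ℤˣ) : walsh S ε * walsh S ε = 1 := by
  rw [walsh, ← Finset.prod_mul_distrib]
  exact Finset.prod_eq_one fun e _ => intCast_units_mul_self _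

lemma measurable_signFlip (ε : ι → ℤˣ) : Measurable (signFlip ε) :=
  measurable_pi_iff.2 fun e => (measurable_pi_apply e).const_mul _

lemma walsh_mulSingle [DecidableEq ι] (S : Finset ι) (e : ι) :
    walsh S (Pi.mulSingle e (-1)) = if e ∈ S then -1 else 1 := by
  simp only [walsh, Pi.mulSingle_apply]
  have : ∀ x, (((if x = e then (-1 : ℤˣ) else 1 : ℤˣ) : ℤ) : ℝ) = if x = e then (-1 : ℝ) else 1 := by
    intro x; split_ifs <;> simp
  simp [this]

lemma signFlip_mulSingle [DecidableEq ι] (e : ι) (J : ι → ℝ) :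
    signFlip (Pi.mulSingle e (-1)) J = Function.update J e (-J e) := by
  funext x
  by_cases hx : x = e
  · subst hx; simp [signFlip]
  · simp [signFlip, hx]

variable [Fintype ι]

/-- The sum is the expansion of `∏ e, (1 + ε e)`, which vanishes as soon as one sign is `-1`. -/
lemma sum_walsh (ε : ι → ℤˣ) :
    ∑ S : Finset ι, walsh S ε = if ε = 1 then 2 ^ Fintype.card ι else 0 := by
  have h := Finset.prod_one_add (f := fun e => ((ε e : ℤ) : ℝ)) (Finset.univ : Finset ι)
  rw [Finset.powerset_univ] at h
  simp only [walsh]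
  rw [← h]
  split_ifs with hε
  · subst hε
    simp [one_add_one_eq_two]
  · obtain ⟨e, he⟩ := Function.ne_iff.1 hε
    refine Finset.prod_eq_zero (Finset.mem_univ e) ?_
    rcases Int.units_eq_one_or (ε e) with h | h
    · exact absurd h he
    · simp [h]

variable [DecidableEq ι]

/-- The component of `f` that is odd in the coordinates in `S` and even in the others. -/
def oddPart (S : Finset ι) (f : (ι → ℝ) → ℝ) (J : ι → ℝ) : ℝ :=
  (2 ^ Fintype.card ι)⁻¹ * ∑ ε : ι → ℤˣ, walsh S ε * f (signFlip ε J)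

lemma oddPart_signFlip (S : Finset ι) (f : (ι → ℝ) → ℝ) (η : ι → ℤˣ) (J : ι → ℝ) :
    oddPart S f (signFlip η J) = walsh S η * oddPart S f J := by
  simp only [oddPart]
  rw [mul_left_comm (walsh S η)]
  congr 1
  rw [Finset.mul_sum, ← Equiv.sum_comp (Equiv.mulRight η) fun ε => walsh S η * (walsh S ε * f (signFlip ε J))]
  refine Finset.sum_congr rfl fun ε _ => ?_
  simp only [Equiv.coe_mulRight, walsh_mul, signFlip_mul]
  linear_combination (-(walsh S ε * f (signFlip ε (signFlip η J)))) * walsh_mul_self S η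

lemma sum_oddPart (f : (ι → ℝ) → ℝ) (J : ι → ℝ) : ∑ S, oddPart S f J = f J := by
  simp only [oddPart]
  rw [← Finset.mul_sum, Finset.sum_comm]
  simp_rw [← Finset.sum_mul, sum_walsh]
  simp only [ite_mul, zero_mul, Finset.sum_ite_eq', Finset.mem_univ, if_true]
  rw [inv_mul_cancel_left₀ (by positivity)]
  congr 1
  funext e; simp [signFlip]

/-- Parseval's identity for the Walsh expansion along the orbit of a fixed `J` under sign changes;
it holds pointwise, before any averaging over `J`. -/
lemma sum_oddPart_sq (f : (ι → ℝ) → ℝ) (J : ι → ℝ) :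
    ∑ S, oddPart S f J ^ 2 = (2 ^ Fintype.card ι)⁻¹ * ∑ ε : ι → ℤˣ, f (signFlip ε J) ^ 2 := by
  have h : ∀ S : Finset ι, oddPart S f J ^ 2 = ((2 ^ Fintype.card ι)⁻¹ : ℝ) ^ 2 *
      ∑ ε : ι → ℤˣ, ∑ η : ι → ℤˣ, walsh S (ε * η) * (f (signFlip ε J) * f (signFlip η J)) := by
    intro S
    rw [oddPart, mul_pow, sq (∑ ε : ι → ℤˣ, _), Finset.sum_mul_sum]
    congr 1
    refine Finset.sum_congr rfl fun ε _ => Finset.sum_congr rfl fun η _ => ?_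
    rw [walsh_mul]; ring
  simp_rw [h]
  rw [← Finset.mul_sum, Finset.sum_comm]
  have h2 : ∀ ε η : ι → ℤˣ, ε * η = 1 ↔ η = ε := fun ε η => by
    constructor
    · intro h; funext e
      have := congrFun h e
      simp only [Pi.mul_apply, Pi.one_apply] at this
      rcases Int.units_eq_one_or (ε e) with h | h <;> rw [h] at this ⊢
      · simpa using this
      · rw [neg_one_mul, neg_eq_iff_eq_neg] at this; exact this
    · rintro rfl; funext e; exact Int.units_mul_self _
  have h3 : ∀ ε : ι → ℤˣ, ∑ S : Finset ι, ∑ η : ι → ℤˣ,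
      walsh S (ε * η) * (f (signFlip ε J) * f (signFlip η J)) =
        2 ^ Fintype.card ι * f (signFlip ε J) ^ 2 := by
    intro ε
    rw [Finset.sum_comm]
    simp_rw [← Finset.sum_mul, sum_walsh, h2]
    simp [sq]
  simp_rw [h3, ← Finset.mul_sum]
  field_simp

lemma sum_oddPart_sq_le {f : (ι → ℝ) → ℝ} (hf : ∀ J, |f J| ≤ 1) (J : ι → ℝ) :
    ∑ S, oddPart S f J ^ 2 ≤ 1 := by
  rw [sum_oddPart_sq, inv_mul_le_iff₀ (by positivity), mul_one]
  refine (Finset.sum_le_card_nsmul _ _ 1 fun ε _ => ?_).trans ?_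
  · exact (sq_le_one_iff_abs_le_one _).2 (hf _)
  · simp

/-- The component is multiplied under `η` both by `s`, inherited from `f`, and by its own character
`walsh S η`. -/
lemma oddPart_eq_zero {f : (ι → ℝ) → ℝ} {η : ι → ℤˣ} {s : ℝ} {S : Finset ι}
    (h : ∀ J, f (signFlip η J) = s * f J) (hs : walsh S η ≠ s) (J : ι → ℝ) :
    oddPart S f J = 0 := by
  have h1 := oddPart_signFlip S f η J
  have h2 : oddPart S f (signFlip η J) = s * oddPart S f J := by
    simp only [oddPart]
    rw [mul_left_comm s]
    congr 1
    rw [Finset.mul_sum]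
    refine Finset.sum_congr rfl fun ε _ => ?_
    rw [← signFlip_mul, mul_comm ε η, signFlip_mul, h]
    ring
  have h3 : (walsh S η - s) * oddPart S f J = 0 := by rw [sub_mul, ← h1, ← h2, sub_self]
  exact (mul_eq_zero.1 h3).resolve_left (sub_ne_zero.2 hs)

lemma measurable_oddPart (S : Finset ι) {f : (ι → ℝ) → ℝ} (hf : Measurable f) :
    Measurable (oddPart S f) :=
  (Finset.measurable_sum _ fun ε _ => (hf.comp (measurable_signFlip ε)).const_mul _).const_mul _

lemma abs_oddPart_le {f : (ι → ℝ) → ℝ} (hf : ∀ J, |f J| ≤ 1) (S : Finset ι) (J : ι → ℝ) :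
    |oddPart S f J| ≤ 1 := by
  rw [← sq_le_one_iff_abs_le_one]
  exact (Finset.single_le_sum (f := fun S => oddPart S f J ^ 2) (fun S _ => sq_nonneg _)
    (Finset.mem_univ S)).trans (sum_oddPart_sq_le hf J)

variable {μ : Measure (ℝ × ℝ)} [IsProbabilityMeasure μ] {c : ℝ}

/-- Negating both copies of the coupling at a point of the symmetric difference of `S` and `T`
preserves the law and negates the integrand. -/
lemma integral_oddPart_mul_oddPart_of_ne
    (hneg : MeasurePreserving (fun z : ℝ × ℝ => (-z.1, -z.2)) μ μ) {f : (ι → ℝ) → ℝ}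
    (hf : Measurable f) {S T : Finset ι} (hST : S ≠ T) :
    ∫ z, oddPart S f (fun e => (z e).1) * oddPart T f (fun e => (z e).2)
      ∂(Measure.pi fun _ : ι => μ) = 0 := by
  obtain ⟨e, he⟩ : ∃ e, ¬(e ∈ S ↔ e ∈ T) := by
    by_contra! h
    exact hST (Finset.ext h)
  let Φ : (ι → ℝ × ℝ) → ι → ℝ × ℝ := fun z i => (if i = e then fun z => (-z.1, -z.2) else id) (z i)
  have hΦ : MeasurePreserving Φ (Measure.pi fun _ : ι => μ) (Measure.pi fun _ : ι => μ) := by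
    refine measurePreserving_pi (fun _ => μ) (fun _ => μ) fun i => ?_
    split_ifs
    · exact hneg
    · exact MeasurePreserving.id μ
  have h1 : ∀ z, (fun i => (Φ z i).1) = signFlip (Pi.mulSingle e (-1)) fun i => (z i).1 := by
    intro z; rw [signFlip_mulSingle]; funext i
    by_cases hi : i = e
    · subst hi; simp [Φ]
    · simp [Φ, hi]
  have h2 : ∀ z, (fun i => (Φ z i).2) = signFlip (Pi.mulSingle e (-1)) fun i => (z i).2 := by
    intro z; rw [signFlip_mulSingle]; funext i
    by_cases hi : i = e
    · subst hi; simp [Φ]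
    · simp [Φ, hi]
  set G : (ι → ℝ × ℝ) → ℝ := fun z =>
    oddPart S f (fun e => (z e).1) * oddPart T f (fun e => (z e).2) with hG
  have hGm : Measurable G :=
    ((measurable_oddPart S hf).comp
      (measurable_pi_iff.2 fun e => (measurable_pi_apply e).fst)).mul
    ((measurable_oddPart T hf).comp
      (measurable_pi_iff.2 fun e => (measurable_pi_apply e).snd))
  have h3 : ∫ z, G z ∂(Measure.pi fun _ : ι => μ) = ∫ z, G (Φ z) ∂(Measure.pi fun _ : ι => μ) := by
    conv_lhs => rw [← hΦ.map_eq]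
    exact integral_map hΦ.measurable.aemeasurable hGm.aestronglyMeasurable
  have h4 : ∀ z, G (Φ z) = -G z := by
    intro z
    simp only [hG, h1, h2, oddPart_signFlip, walsh_mulSingle]
    by_cases hS : e ∈ S <;> by_cases hT : e ∈ T
    · exact absurd (iff_of_true hS hT) he
    · simp [hS, hT]
    · simp [hS, hT]
    · exact absurd (iff_of_false hS hT) he
  simp only [h4, integral_neg] at h3
  linarith

/-- Expand both factors by parity. Only equal sets survive, each gains `c ^ S.card ≤ c ^ k`, and by
Parseval the squared norms add up to at most 1. -/
theorem OddCorrelationLE.integral_mul_le (hμ : OddCorrelationLE μ c) (hc0 : 0 ≤ c) (hc1 : c ≤ 1)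
    (h1 : MeasurePreserving Prod.fst μ (gaussianReal 0 1))
    (h2 : MeasurePreserving Prod.snd μ (gaussianReal 0 1))
    (hneg : MeasurePreserving (fun z : ℝ × ℝ => (-z.1, -z.2)) μ μ) {f : (ι → ℝ) → ℝ}
    (hf : Measurable f) (hf1 : ∀ J, |f J| ≤ 1) {k : ℕ}
    (hk : ∀ S : Finset ι, S.card < k → ∀ J, oddPart S f J = 0) :
    ∫ z, f (fun e => (z e).1) * f (fun e => (z e).2) ∂(Measure.pi fun _ : ι => μ) ≤ c ^ k := by
  set γ := Measure.pi fun _ : ι => gaussianReal 0 1 with hγ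
  have hm := measurable_oddPart (ι := ι) (f := f)
  have hb := abs_oddPart_le hf1
  have hfst : Measurable fun z : ι → ℝ × ℝ => fun e => (z e).1 :=
    measurable_pi_iff.2 fun e => (measurable_pi_apply e).fst
  have hsnd : Measurable fun z : ι → ℝ × ℝ => fun e => (z e).2 :=
    measurable_pi_iff.2 fun e => (measurable_pi_apply e).snd
  have hint : ∀ S T : Finset ι, Integrable (fun z : ι → ℝ × ℝ =>
      oddPart S f (fun e => (z e).1) * oddPart T f (fun e => (z e).2))
      (Measure.pi fun _ : ι => μ) := fun S T =>
    integrable_of_abs_le (M := 1) (((hm S hf).comp hfst).mul ((hm T hf).comp hsnd)) fun z => by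
      rw [abs_mul]; exact mul_le_one₀ (hb _ _) (abs_nonneg _) (hb _ _)
  have hsq : ∀ S, Integrable (fun x => oddPart S f x ^ 2) γ := fun S =>
    integrable_of_abs_le (M := 1) ((hm S hf).pow_const 2) fun z => by
      rw [abs_pow]; exact pow_le_one₀ (abs_nonneg _) (hb _ _)
  have hexp : ∀ z : ι → ℝ × ℝ, f (fun e => (z e).1) * f (fun e => (z e).2) =
      ∑ S, ∑ T, oddPart S f (fun e => (z e).1) * oddPart T f (fun e => (z e).2) := fun z => by
    rw [← Finset.sum_mul_sum, sum_oddPart, sum_oddPart]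
  simp_rw [hexp]
  rw [integral_finsetSum _ fun S _ => integrable_finsetSum _ fun T _ => hint S T]
  have hS : ∀ S : Finset ι, ∫ z, ∑ T, oddPart S f (fun e => (z e).1) *
      oddPart T f (fun e => (z e).2) ∂(Measure.pi fun _ : ι => μ) ≤
        c ^ k * ∫ x, oddPart S f x ^ 2 ∂γ := by
    intro S
    rw [integral_finsetSum _ fun T _ => hint S T, Finset.sum_eq_single S
      (fun T _ hT => integral_oddPart_mul_oddPart_of_ne hneg hf hT.symm)
      (fun h => absurd (Finset.mem_univ S) h)]
    rcases lt_or_ge S.card k with hlt | hge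
    · simp [hk S hlt]
    · refine (le_abs_self _).trans ((hμ.pi hc0 h1 h2 S (hm S hf) (hb S) fun e he x => ?_).trans ?_)
      · rw [← signFlip_mulSingle, oddPart_signFlip, walsh_mulSingle, if_pos he, neg_one_mul]
      · exact mul_le_mul_of_nonneg_right (pow_le_pow_of_le_one hc0 hc1 hge)
          (integral_nonneg fun x => sq_nonneg _)
  refine (Finset.sum_le_sum fun S _ => hS S).trans ?_
  rw [← Finset.mul_sum, ← integral_finsetSum _ fun S _ => hsq S]
  refine mul_le_of_le_one_right (pow_nonneg hc0 k) ?_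
  refine (integral_mono (integrable_finsetSum _ fun S _ => hsq S) (integrable_const (1 : ℝ))
    fun x => sum_oddPart_sq_le hf1 x).trans ?_
  simp

end Parity

/-! ### The pair law -/

lemma measurable_continuousPair (t : ℝ) : Measurable fun x : ℝ × ℝ =>
    (x.1, Real.exp (-t) * x.1 + √(1 - Real.exp (-2 * t)) * x.2) := by fun_prop

lemma measurable_discretePair : Measurable fun x : (ℝ × ℝ) × ℝ =>
    (x.1.1, x.2 * x.1.1 + (1 - x.2) * x.1.2) := by fun_prop

instance (t : ℝ) (κ : Perturbation) : IsProbabilityMeasure (pairLaw t κ) := by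
  cases κ
  · exact Measure.isProbabilityMeasure_map (measurable_continuousPair t).aemeasurable
  · exact Measure.isProbabilityMeasure_map measurable_discretePair.aemeasurable

lemma measurePreserving_fst_pairLaw (t : ℝ) (κ : Perturbation) :
    MeasurePreserving Prod.fst (pairLaw t κ) (gaussianReal 0 1) := by
  refine ⟨measurable_fst, ?_⟩
  cases κ
  · rw [pairLaw, Measure.map_map measurable_fst (measurable_continuousPair t)]
    exact measurePreserving_fst.map_eq
  · rw [pairLaw, Measure.map_map measurable_fst measurable_discretePair]
    exact (measurePreserving_fst.comp measurePreserving_fst).map_eq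

lemma measurePreserving_snd_pairLaw {t : ℝ} (ht : 0 ≤ t) (κ : Perturbation) :
    MeasurePreserving Prod.snd (pairLaw t κ) (gaussianReal 0 1) := by
  refine ⟨measurable_snd, ?_⟩
  cases κ
  · rw [pairLaw, Measure.map_map measurable_snd (measurable_continuousPair t)]
    have he : Real.exp (-2 * t) = Real.exp (-t) ^ 2 := by
      rw [← Real.exp_nat_mul]; congr 1; push_cast; ring
    have hle : Real.exp (-2 * t) ≤ 1 := Real.exp_le_one_iff.2 (by linarith)
    set c := Real.exp (-t)
    set s := √(1 - Real.exp (-2 * t))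
    have hs : s ^ 2 = 1 - c ^ 2 := by rw [Real.sq_sqrt (by linarith), he]
    have hind : IndepFun (fun x : ℝ × ℝ => c * x.1) (fun x : ℝ × ℝ => s * x.2)
        ((gaussianReal 0 1).prod (gaussianReal 0 1)) :=
      indepFun_prod (X := fun x : ℝ => c * x) (Y := fun x : ℝ => s * x) (by fun_prop) (by fun_prop)
    have hX : ((gaussianReal 0 1).prod (gaussianReal 0 1)).map (fun x : ℝ × ℝ => c * x.1) =
        gaussianReal 0 ⟨c ^ 2, sq_nonneg c⟩ := by
      have : (fun x : ℝ × ℝ => c * x.1) = (c * ·) ∘ Prod.fst := rfl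
      rw [this, ← Measure.map_map (by fun_prop) (by fun_prop), measurePreserving_fst.map_eq,
        gaussianReal_map_const_mul]
      simp only [mul_zero, mul_one]; rfl
    have hY : ((gaussianReal 0 1).prod (gaussianReal 0 1)).map (fun x : ℝ × ℝ => s * x.2) =
        gaussianReal 0 ⟨s ^ 2, sq_nonneg s⟩ := by
      have : (fun x : ℝ × ℝ => s * x.2) = (s * ·) ∘ Prod.snd := rfl
      rw [this, ← Measure.map_map (by fun_prop) (by fun_prop), measurePreserving_snd.map_eq,
        gaussianReal_map_const_mul]
      simp only [mul_zero, mul_one]; rfl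
    have h := gaussianReal_add_gaussianReal_of_indepFun hind hX hY
    have hv : (⟨c ^ 2, sq_nonneg c⟩ + ⟨s ^ 2, sq_nonneg s⟩ : NNReal) = 1 := by
      apply NNReal.eq
      change c ^ 2 + s ^ 2 = 1
      rw [hs]; ring
    rw [hv, add_zero] at h
    exact h
  · rw [pairLaw, Measure.map_map measurable_snd measurable_discretePair]
    ext s hs
    have hm : Measurable (Prod.snd ∘ fun x : (ℝ × ℝ) × ℝ =>
        (x.1.1, x.2 * x.1.1 + (1 - x.2) * x.1.2)) := measurable_snd.comp measurable_discretePair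
    rw [Measure.map_apply hm hs, Measure.prod_apply_symm (hm hs), bernoulliMeasure_def,
      lintegral_add_measure, lintegral_smul_measure, lintegral_smul_measure, lintegral_dirac,
      lintegral_dirac]
    have e1 : (fun x : ℝ × ℝ => (x, (1 : ℝ))) ⁻¹' ((Prod.snd ∘ fun x : (ℝ × ℝ) × ℝ =>
        (x.1.1, x.2 * x.1.1 + (1 - x.2) * x.1.2)) ⁻¹' s) = Prod.fst ⁻¹' s := by
      ext x; simp
    have e0 : (fun x : ℝ × ℝ => (x, (0 : ℝ))) ⁻¹' ((Prod.snd ∘ fun x : (ℝ × ℝ) × ℝ =>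
        (x.1.1, x.2 * x.1.1 + (1 - x.2) * x.1.2)) ⁻¹' s) = Prod.snd ⁻¹' s := by
      ext x; simp
    rw [e1, e0, measurePreserving_fst.measure_preimage hs.nullMeasurableSet,
      measurePreserving_snd.measure_preimage hs.nullMeasurableSet, ← add_smul,
      unitInterval.toNNReal_add_toNNReal_symm, one_smul]

lemma measurePreserving_neg_pairLaw (t : ℝ) (κ : Perturbation) :
    MeasurePreserving (fun z : ℝ × ℝ => (-z.1, -z.2)) (pairLaw t κ) (pairLaw t κ) := by
  have hn : MeasurePreserving (fun x : ℝ => -x) (gaussianReal 0 1) (gaussianReal 0 1) :=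
    ⟨measurable_neg, by rw [gaussianReal_map_neg, neg_zero]⟩
  have hm : Measurable fun z : ℝ × ℝ => (-z.1, -z.2) := by fun_prop
  refine ⟨hm, ?_⟩
  cases κ
  · have h := (hn.prod hn).map_eq
    conv_rhs => rw [pairLaw, ← h]
    rw [pairLaw, Measure.map_map hm (measurable_continuousPair t),
      Measure.map_map (measurable_continuousPair t) (hn.prod hn).measurable]
    congr 1
    funext x
    simp only [Function.comp, Prod.map, Prod.mk.injEq, true_and]
    ring
  · have hp := (hn.prod hn).prod
      (MeasurePreserving.id (bernoulliMeasure (1 : ℝ) 0 (toUnit (Real.exp (-t)))))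
    have h := hp.map_eq
    conv_rhs => rw [pairLaw, ← h]
    rw [pairLaw, Measure.map_map hm measurable_discretePair,
      Measure.map_map measurable_discretePair hp.measurable]
    congr 1
    funext x
    simp only [Function.comp, Prod.map, id, Prod.mk.injEq, true_and]
    ring

/-! ### Gibbs correlations -/

section Gibbs

variable {N : ℕ}

lemma abs_spin (σ : Config N) (i : Fin N) : |spin σ i| = 1 := by
  rcases Int.units_eq_one_or (σ i) with h | h <;> simp [spin, h]

lemma groundStates_nonempty (H : Config N → ℝ) : (groundStates H).Nonempty := by
  obtain ⟨σ, -, hσ⟩ := Finset.exists_max_image (Finset.univ : Finset (Config N)) H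
    Finset.univ_nonempty
  exact ⟨σ, by simpa [groundStates] using fun τ => hσ τ (Finset.mem_univ τ)⟩

lemma gibbs_nonneg (β : ℝ≥0∞) (H : Config N → ℝ) (σ : Config N) : 0 ≤ gibbs β H σ := by
  unfold gibbs
  split_ifs <;> positivity

lemma sum_gibbs (β : ℝ≥0∞) (H : Config N → ℝ) : ∑ σ, gibbs β H σ = 1 := by
  unfold gibbs
  split_ifs with h
  · have : ((groundStates H).card : ℝ) ≠ 0 := by
      exact_mod_cast (Finset.card_pos.2 (groundStates_nonempty H)).ne'
    simp [this]
  · rw [← Finset.sum_div, div_self]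
    exact (Finset.sum_pos (fun σ _ => Real.exp_pos _) Finset.univ_nonempty).ne'

lemma mem_groundStates {H : Config N → ℝ} {σ : Config N} :
    σ ∈ groundStates H ↔ ∀ τ, H τ ≤ H σ := by simp [groundStates]

lemma gibbs_comp_equiv (β : ℝ≥0∞) (H : Config N → ℝ) (φ : Config N ≃ Config N) (σ : Config N) :
    gibbs β (fun τ => H (φ τ)) σ = gibbs β H (φ σ) := by
  have hmem : ∀ τ, τ ∈ groundStates (fun τ => H (φ τ)) ↔ φ τ ∈ groundStates H := fun τ => by
    simp only [mem_groundStates]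
    exact φ.forall_congr_left.trans (by simp)
  have hcard : (groundStates fun τ => H (φ τ)).card = (groundStates H).card :=
    Finset.card_bij (fun τ _ => φ τ) (fun τ h => (hmem τ).1 h) (fun _ _ _ _ h => φ.injective h)
      fun τ h => ⟨φ.symm τ, (hmem _).2 (by simpa using h), by simp⟩
  unfold gibbs
  split_ifs with h1 h2 h3 h3
  · rw [hcard]
  · exact absurd ((hmem σ).1 h2) h3
  · exact absurd ((hmem σ).2 h3) h2
  · rfl
  · rw [Equiv.sum_comp φ fun τ => Real.exp (β.toReal * H τ)]

lemma measurable_gibbs {Ω : Type*} [MeasurableSpace Ω] (β : ℝ≥0∞) {H : Ω → Config N → ℝ}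
    (hH : ∀ σ, Measurable fun ω => H ω σ) (σ : Config N) :
    Measurable fun ω => gibbs β (H ω) σ := by
  classical
  have hset : ∀ σ, MeasurableSet {ω | σ ∈ groundStates (H ω)} := fun σ => by
    simp only [mem_groundStates, Set.ofPred_forall]
    exact MeasurableSet.iInter fun τ => measurableSet_le (hH τ) (hH σ)
  unfold gibbs
  by_cases h : β = ∞
  · simp only [h, if_true]
    have hcard : Measurable fun ω => ((groundStates (H ω)).card : ℝ) := by
      have : ∀ ω, ((groundStates (H ω)).card : ℝ) =
          ∑ σ, if σ ∈ groundStates (H ω) then (1 : ℝ) else 0 := fun ω => by simp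
      simp only [this]
      exact Finset.measurable_sum _ fun σ _ =>
        Measurable.ite (hset σ) measurable_const measurable_const
    refine Measurable.ite (hset σ) ?_ measurable_const
    exact hcard.const_div 1
  · simp only [h, if_false]
    exact (((hH σ).const_mul _).exp).div
      (Finset.measurable_sum _ fun τ _ => ((hH τ).const_mul _).exp)

/-- The two-point correlation `⟨σ_i σ_j⟩` of the Gibbs measure. -/
def corr (β : ℝ≥0∞) (i j : Fin N) (H : Config N → ℝ) : ℝ :=
  ∑ σ, spin σ i * spin σ j * gibbs β H σ

lemma abs_corr_le (β : ℝ≥0∞) (i j : Fin N) (H : Config N → ℝ) : |corr β i j H| ≤ 1 := by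
  rw [← sum_gibbs β H]
  refine (Finset.abs_sum_le_sum_abs _ _).trans (Finset.sum_le_sum fun σ _ => ?_)
  rw [abs_mul, abs_mul, abs_spin, abs_spin, abs_of_nonneg (gibbs_nonneg β H σ)]
  simp

lemma measurable_corr {Ω : Type*} [MeasurableSpace Ω] (β : ℝ≥0∞) (i j : Fin N)
    {H : Ω → Config N → ℝ} (hH : ∀ σ, Measurable fun ω => H ω σ) :
    Measurable fun ω => corr β i j (H ω) :=
  Finset.measurable_sum _ fun σ _ => (measurable_gibbs β hH σ).const_mul _

/-- Expanding the square of the overlap separates `σ` from `τ`, which are independent. -/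
lemma gibbsOverlapSq_eq (β : ℝ≥0∞) (H H' : Config N → ℝ) :
    gibbsOverlapSq β H H' = (1 / (N : ℝ)) ^ 2 * ∑ i, ∑ j, corr β i j H * corr β i j H' := by
  have h : ∀ σ τ : Config N, overlap σ τ ^ 2 * (gibbs β H σ * gibbs β H' τ) =
      (1 / (N : ℝ)) ^ 2 * ∑ i, ∑ j, (spin σ i * spin σ j * gibbs β H σ) *
        (spin τ i * spin τ j * gibbs β H' τ) := by
    intro σ τ
    rw [overlap, mul_pow, sq (∑ i, _), Finset.sum_mul_sum, mul_assoc, Finset.sum_mul]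
    simp_rw [Finset.sum_mul]
    congr 1
    exact Finset.sum_congr rfl fun i _ => Finset.sum_congr rfl fun j _ => by ring
  simp only [gibbsOverlapSq, h, ← Finset.mul_sum]
  congr 1
  simp only [corr, Finset.sum_mul_sum]
  calc _ = ∑ σ, ∑ i, ∑ j, ∑ τ, (spin σ i * spin σ j * gibbs β H σ) *
        (spin τ i * spin τ j * gibbs β H' τ) := by
        refine Finset.sum_congr rfl fun σ _ => ?_
        rw [Finset.sum_comm]
        exact Finset.sum_congr rfl fun i _ => Finset.sum_comm
    _ = _ := by
        rw [Finset.sum_comm]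
        exact Finset.sum_congr rfl fun i _ => Finset.sum_comm

/-- Flip the spin at `v`. -/
def spinFlip (v : Fin N) : Config N ≃ Config N := Equiv.mulRight (Pi.mulSingle v (-1))

lemma spin_spinFlip (v : Fin N) (σ : Config N) (i : Fin N) :
    spin (spinFlip v σ) i = (if i = v then -1 else 1) * spin σ i := by
  by_cases h : i = v
  · subst h; simp [spin, spinFlip]
  · simp [spin, spinFlip, h]

lemma corr_comp_spinFlip (β : ℝ≥0∞) (i j v : Fin N) (H : Config N → ℝ) :
    corr β i j (fun σ => H (spinFlip v σ)) =
      ((if i = v then -1 else 1) * (if j = v then -1 else 1)) * corr β i j H := by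
  simp only [corr]
  rw [← Equiv.sum_comp (spinFlip v) fun σ => spin σ i * spin σ j * gibbs β H σ, Finset.mul_sum]
  refine Finset.sum_congr rfl fun σ _ => ?_
  rw [gibbs_comp_equiv, spin_spinFlip, spin_spinFlip]
  split_ifs <;> ring

end Gibbs

/-! ### Gauge symmetry and the parity of Gibbs correlations -/

section Hamiltonian

variable {N Δ : ℕ} {ρ : ℕ → ℝ → ℝ}

lemma measurable_hamiltonian (hρ : ∀ p, 2 ≤ p → p ≤ Δ → Function.Odd (ρ p) ∧ Measurable (ρ p))
    (σ : Config N) : Measurable fun ω : (Hyperedge N Δ → Bool) × (Hyperedge N Δ → ℝ) =>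
      hamiltonian ρ ω.1 ω.2 σ := by
  simp only [hamiltonian, Finset.sum_filter]
  refine Finset.measurable_sum _ fun e _ => Measurable.ite ?_ ?_ measurable_const
  · exact measurableSet_eq_fun ((measurable_pi_apply e).comp measurable_fst) measurable_const
  · exact (((hρ _ e.2.1 e.2.2).2.comp ((measurable_pi_apply e).comp measurable_snd))).mul_const _

lemma hamiltonian_signFlip_of_subset {X : Hyperedge N Δ → Bool} {η : Hyperedge N Δ → ℤˣ}
    (h : ∀ e, X e = true → η e = 1) (J : Hyperedge N Δ → ℝ) :
    hamiltonian ρ X (signFlip η J) = hamiltonian ρ X J := by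
  funext σ
  refine Finset.sum_congr rfl fun e he => ?_
  simp [signFlip, h e (Finset.mem_filter.1 he).2]

/-- The signs on hyperedges induced by a spin flip at `v`. -/
def gaugeSign (v : Fin N) (e : Hyperedge N Δ) : ℤˣ := if v ∈ e.1 then -1 else 1

/-- Gauge symmetry: flipping the spin at `v` negates exactly the monomials with `v ∈ e`, and since
`ρ` is odd this sign can be moved into the coupling. -/
lemma hamiltonian_gaugeSign
    (hρ : ∀ p, 2 ≤ p → p ≤ Δ → Function.Odd (ρ p) ∧ Measurable (ρ p))
    (X : Hyperedge N Δ → Bool) (v : Fin N) (J : Hyperedge N Δ → ℝ) :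
    hamiltonian ρ X (signFlip (gaugeSign v) J) = fun σ => hamiltonian ρ X J (spinFlip v σ) := by
  funext σ
  refine Finset.sum_congr rfl fun e _ => ?_
  simp only [spin_spinFlip, Finset.prod_mul_distrib, Finset.prod_ite_eq', signFlip, gaugeSign]
  split_ifs
  · simp [(hρ _ e.2.1 e.2.2).1 (J e)]
  · simp

lemma walsh_gaugeSign (S : Finset (Hyperedge N Δ)) (v : Fin N) :
    walsh S (gaugeSign v) = (-1) ^ (S.filter fun e => v ∈ e.1).card := by
  simp only [walsh, gaugeSign]
  rw [Finset.card_filter, ← Finset.prod_pow_eq_pow_sum]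
  refine Finset.prod_congr rfl fun e _ => ?_
  split_ifs <;> simp

/-- The vertices of odd degree in `S` are exactly `i` and `j`. -/
def HasOddBoundary (S : Finset (Hyperedge N Δ)) (i j : Fin N) : Prop :=
  ∀ v, Odd (S.filter fun e => v ∈ e.1).card ↔ v = i ∨ v = j

/-- Two symmetries restrict `S`. The correlation does not depend on couplings of absent hyperedges,
so it is even in them. A spin flip at `v` multiplies it by `-1` exactly when `v` is `i` or `j`,
while the component of `S` picks up `(-1)` to the degree of `v` in `S`. -/
lemma hasOddBoundary_of_oddPart_ne_zero
    (hρ : ∀ p, 2 ≤ p → p ≤ Δ → Function.Odd (ρ p) ∧ Measurable (ρ p))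
    {X : Hyperedge N Δ → Bool} {β : ℝ≥0∞} {i j : Fin N} (hij : i ≠ j)
    {S : Finset (Hyperedge N Δ)} {J : Hyperedge N Δ → ℝ}
    (h : oddPart S (fun J => corr β i j (hamiltonian ρ X J)) J ≠ 0) :
    (∀ e ∈ S, X e = true) ∧ HasOddBoundary S i j := by
  constructor
  · intro e he
    by_contra hX
    refine h (oddPart_eq_zero (η := Pi.mulSingle e (-1)) (s := 1) (fun J => ?_) ?_ J)
    · rw [hamiltonian_signFlip_of_subset, one_mul]
      intro e' he'
      have : e' ≠ e := by rintro rfl; exact hX he'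
      simp [this]
    · rw [walsh_mulSingle, if_pos he]; norm_num
  · intro v
    by_contra hv
    refine h (oddPart_eq_zero (η := gaugeSign v)
      (s := (if i = v then -1 else 1) * (if j = v then -1 else 1)) (fun J => ?_) ?_ J)
    · rw [hamiltonian_gaugeSign hρ, corr_comp_spinFlip]
    · rw [walsh_gaugeSign]
      intro h1
      apply hv
      rcases Nat.even_or_odd (S.filter fun e => v ∈ e.1).card with h2 | h2
      · rw [h2.neg_one_pow] at h1
        refine iff_of_false (Nat.not_odd_iff_even.2 h2) ?_
        rintro (rfl | rfl)
        · rw [if_pos rfl, if_neg hij.symm] at h1; norm_num at h1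
        · rw [if_pos rfl, if_neg hij] at h1; norm_num at h1
      · rw [h2.neg_one_pow] at h1
        refine iff_of_true h2 ?_
        by_contra! h3
        rw [if_neg (Ne.symm h3.1), if_neg (Ne.symm h3.2)] at h1
        norm_num at h1

/-- Some set of fewer than `k` present hyperedges has odd boundary `{i, j}`. -/
def HasShortBoundary (X : Hyperedge N Δ → Bool) (k : ℕ) (i j : Fin N) : Prop :=
  ∃ S : Finset (Hyperedge N Δ), (∀ e ∈ S, X e = true) ∧ HasOddBoundary S i j ∧ S.card < k

lemma measurable_overlapSqAvg
    (hρ : ∀ p, 2 ≤ p → p ≤ Δ → Function.Odd (ρ p) ∧ Measurable (ρ p)) (β : ℝ≥0∞) :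
    Measurable (overlapSqAvg (N := N) (Δ := Δ) ρ β) := by
  unfold overlapSqAvg
  simp only [gibbsOverlapSq_eq]
  have h1 : Measurable fun ω : (Hyperedge N Δ → Bool) × (Hyperedge N Δ → ℝ × ℝ) =>
      (ω.1, fun e => (ω.2 e).1) := measurable_fst.prodMk
    (measurable_pi_iff.2 fun e => ((measurable_pi_apply e).comp measurable_snd).fst)
  have h2 : Measurable fun ω : (Hyperedge N Δ → Bool) × (Hyperedge N Δ → ℝ × ℝ) =>
      (ω.1, fun e => (ω.2 e).2) := measurable_fst.prodMk
    (measurable_pi_iff.2 fun e => ((measurable_pi_apply e).comp measurable_snd).snd)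
  exact (Finset.measurable_sum _ fun i _ => Finset.measurable_sum _ fun j _ =>
    (measurable_corr β i j fun σ => (measurable_hamiltonian hρ σ).comp h1).mul
    (measurable_corr β i j fun σ => (measurable_hamiltonian hρ σ).comp h2)).const_mul _

lemma abs_overlapSqAvg_le (β : ℝ≥0∞)
    (ω : (Hyperedge N Δ → Bool) × (Hyperedge N Δ → ℝ × ℝ)) : |overlapSqAvg ρ β ω| ≤ 1 := by
  rw [overlapSqAvg, gibbsOverlapSq_eq, abs_mul, abs_of_nonneg (by positivity)]
  have h : |∑ i, ∑ j, corr β i j (hamiltonian ρ ω.1 fun e => (ω.2 e).1) *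
      corr β i j (hamiltonian ρ ω.1 fun e => (ω.2 e).2)| ≤ (N : ℝ) ^ 2 := by
    refine (Finset.abs_sum_le_sum_abs _ _).trans ((Finset.sum_le_sum fun i _ =>
      Finset.abs_sum_le_sum_abs _ _).trans ((Finset.sum_le_sum fun i _ => Finset.sum_le_sum
        fun j _ => ?_).trans (b := ∑ i : Fin N, ∑ j : Fin N, (1 : ℝ)) ?_))
    · rw [abs_mul]
      exact mul_le_one₀ (abs_corr_le _ _ _ _) (abs_nonneg _) (abs_corr_le _ _ _ _)
    · simp [sq]
  refine (mul_le_mul_of_nonneg_left h (by positivity)).trans ?_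
  rcases Nat.eq_zero_or_pos N with rfl | hN
  · simp
  · field_simp; rfl

open Classical in
/-- For a fixed hypergraph, chaos holds for the pairs of vertices that are not the odd boundary of
a small set of hyperedges. -/
theorem integral_overlapSqAvg_le
    (hρ : ∀ p, 2 ≤ p → p ≤ Δ → Function.Odd (ρ p) ∧ Measurable (ρ p)) (κ : Perturbation)
    {t : ℝ} (ht : 0 ≤ t) (β : ℝ≥0∞) (k : ℕ) (X : Hyperedge N Δ → Bool) :
    ∫ z, overlapSqAvg ρ β (X, z) ∂(Measure.pi fun _ : Hyperedge N Δ => pairLaw t κ) ≤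
      (1 / (N : ℝ)) ^ 2 * ∑ i, ∑ j, ((if i = j then 1 else 0) +
        (if i ≠ j ∧ HasShortBoundary X k i j then 1 else 0) + Real.exp (-t) ^ k) := by
  simp only [overlapSqAvg, gibbsOverlapSq_eq]
  have hf : ∀ i j, Measurable fun J : Hyperedge N Δ → ℝ => corr β i j (hamiltonian ρ X J) :=
    fun i j => measurable_corr β i j fun σ =>
      (measurable_hamiltonian hρ σ).comp measurable_prodMk_left
  have hfst : Measurable fun z : Hyperedge N Δ → ℝ × ℝ => fun e => (z e).1 :=
    measurable_pi_iff.2 fun e => (measurable_pi_apply e).fst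
  have hsnd : Measurable fun z : Hyperedge N Δ → ℝ × ℝ => fun e => (z e).2 :=
    measurable_pi_iff.2 fun e => (measurable_pi_apply e).snd
  have hb : ∀ i j (z : Hyperedge N Δ → ℝ × ℝ), |corr β i j (hamiltonian ρ X fun e => (z e).1) *
      corr β i j (hamiltonian ρ X fun e => (z e).2)| ≤ 1 := fun i j z => by
    rw [abs_mul]
    exact mul_le_one₀ (abs_corr_le _ _ _ _) (abs_nonneg _) (abs_corr_le _ _ _ _)
  have hint : ∀ i j, Integrable (fun z : Hyperedge N Δ → ℝ × ℝ =>
      corr β i j (hamiltonian ρ X fun e => (z e).1) *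
      corr β i j (hamiltonian ρ X fun e => (z e).2))
      (Measure.pi fun _ : Hyperedge N Δ => pairLaw t κ) := fun i j =>
    integrable_of_abs_le (((hf i j).comp hfst).mul ((hf i j).comp hsnd)) (hb i j)
  rw [integral_const_mul, integral_finsetSum _ fun i _ => integrable_finsetSum _ fun j _ => hint i j]
  refine mul_le_mul_of_nonneg_left (Finset.sum_le_sum fun i _ => ?_) (by positivity)
  rw [integral_finsetSum _ fun j _ => hint i j]
  refine Finset.sum_le_sum fun j _ => ?_
  have hle1 : ∫ z, corr β i j (hamiltonian ρ X fun e => (z e).1) *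
      corr β i j (hamiltonian ρ X fun e => (z e).2)
      ∂(Measure.pi fun _ : Hyperedge N Δ => pairLaw t κ) ≤ 1 := by
    refine (integral_mono (hint i j) (integrable_const (1 : ℝ))
      fun z => le_of_abs_le (hb i j z)).trans ?_
    simp
  have hexp : 0 ≤ Real.exp (-t) ^ k := by positivity
  by_cases hij : i = j
  · simp only [hij, if_true, ne_eq, not_true, false_and, if_false]
    subst hij
    linarith
  · by_cases hS : HasShortBoundary X k i j
    · simp only [hij, hS, if_false, ne_eq, not_false_eq_true, true_and, if_true]
      linarith
    · simp only [hS, hij, and_false, if_false, zero_add]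
      refine (oddCorrelationLE_pairLaw ht κ).integral_mul_le (Real.exp_pos _).le
        (Real.exp_le_one_iff.2 (by linarith)) (measurePreserving_fst_pairLaw t κ)
        (measurePreserving_snd_pairLaw ht κ) (measurePreserving_neg_pairLaw t κ) (hf i j)
        (fun J => abs_corr_le _ _ _ _) fun S hlt J => ?_
      by_contra hne
      obtain ⟨h1, h2⟩ := hasOddBoundary_of_oddPart_ne_zero hρ hij hne
      exact hS ⟨S, h1, h2, hlt⟩

end Hamiltonian

/-! ### Trails in a hypergraph -/

section Trails

variable {N Δ : ℕ}

/-- The last vertex of a trail from `i`, stored as the list of its steps with the newest first. -/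
def trailEnd (i : Fin N) : List (Hyperedge N Δ × Fin N) → Fin N
  | [] => i
  | a :: _ => a.2

/-- The vertices met by the hyperedges of a trail from `i`. -/
def trailSupport (i : Fin N) (l : List (Hyperedge N Δ × Fin N)) : Finset (Fin N) :=
  insert i (l.toFinset.biUnion fun a => a.1.1)

/-- The last step of the trail returns to a vertex met by the previous steps. -/
def trailCloses (i : Fin N) : List (Hyperedge N Δ × Fin N) → Prop
  | [] => False
  | a :: l => a.2 ∈ trailSupport i l

/-- The step `a` extends the trail `l` from `i` along a new hyperedge to a different vertex. -/
def IsStep (i : Fin N) (l : List (Hyperedge N Δ × Fin N)) (a : Hyperedge N Δ × Fin N) : Prop :=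
  a.1 ∉ l.map Prod.fst ∧ trailEnd i l ∈ a.1.1 ∧ a.2 ∈ a.1.1 ∧ a.2 ≠ trailEnd i l

open Classical in
/-- The trails of length `n` from `i`, without repeated hyperedges. -/
def trails (i : Fin N) : ℕ → Finset (List (Hyperedge N Δ × Fin N))
  | 0 => {[]}
  | n + 1 => ((trails i n ×ˢ Finset.univ).filter fun x => IsStep i x.1 x.2).image
      fun x => x.2 :: x.1

lemma mem_trails_succ {i : Fin N} {n : ℕ} {l : List (Hyperedge N Δ × Fin N)} :
    l ∈ trails i (n + 1) ↔ ∃ a l', l = a :: l' ∧ l' ∈ trails i n ∧ IsStep i l' a := by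
  classical
  simp only [trails, Finset.mem_image, Finset.mem_filter, Finset.mem_product, Finset.mem_univ,
    and_true]
  constructor
  · rintro ⟨⟨l', a⟩, ⟨h1, h2⟩, rfl⟩
    exact ⟨_, _, rfl, h1, h2⟩
  · rintro ⟨a, l', rfl, h1, h2⟩
    exact ⟨(l', a), ⟨h1, h2⟩, rfl⟩

open Classical in
lemma sum_trails_succ (i : Fin N) (n : ℕ) (f : List (Hyperedge N Δ × Fin N) → ℝ) :
    ∑ l ∈ trails i (n + 1), f l =
      ∑ l ∈ trails i n, ∑ e : Hyperedge N Δ, ∑ w, if IsStep i l (e, w) then f ((e, w) :: l) else 0 := by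
  rw [trails, Finset.sum_image, Finset.sum_filter, Finset.sum_product]
  · exact Finset.sum_congr rfl fun l _ => Fintype.sum_prod_type _
  · rintro ⟨l, a⟩ _ ⟨l', a'⟩ _ h
    simp only [List.cons.injEq] at h
    rw [h.1, h.2]

lemma length_of_mem_trails {i : Fin N} {n : ℕ} {l : List (Hyperedge N Δ × Fin N)}
    (h : l ∈ trails i n) : l.length = n := by
  induction n generalizing l with
  | zero => simp [trails] at h; simp [h]
  | succ n ih =>
    obtain ⟨a, l', rfl, h1, -⟩ := mem_trails_succ.1 h
    simp [ih h1]

lemma nodup_of_mem_trails {i : Fin N} {n : ℕ} {l : List (Hyperedge N Δ × Fin N)}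
    (h : l ∈ trails i n) : (l.map Prod.fst).Nodup := by
  induction n generalizing l with
  | zero => simp [trails] at h; simp [h]
  | succ n ih =>
    obtain ⟨a, l', rfl, h1, h2⟩ := mem_trails_succ.1 h
    rw [List.map_cons, List.nodup_cons]
    exact ⟨h2.1, ih h1⟩

lemma card_trailSupport_le (i : Fin N) (l : List (Hyperedge N Δ × Fin N)) :
    (trailSupport i l).card ≤ 1 + l.length * Δ := by
  refine (Finset.card_insert_le _ _).trans ?_
  rw [add_comm]
  refine Nat.add_le_add_left (Finset.card_biUnion_le.trans ?_) 1
  refine (Finset.sum_le_card_nsmul _ _ Δ fun a _ => a.1.2.2).trans ?_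
  rw [smul_eq_mul]
  exact Nat.mul_le_mul_right _ (List.toFinset_card_le l)

lemma card_ge_of_mem_trails {i : Fin N} {n : ℕ} {l : List (Hyperedge N Δ × Fin N)}
    (h : l ∈ trails i n) {S : Finset (Hyperedge N Δ)} (hS : ∀ a ∈ l, a.1 ∈ S) : n ≤ S.card := by
  have h1 : (l.map Prod.fst).toFinset ⊆ S := fun e he => by
    obtain ⟨a, ha, rfl⟩ := List.mem_map.1 (List.mem_toFinset.1 he)
    exact hS a ha
  have h2 := Finset.card_le_card h1
  rwa [List.toFinset_card_of_nodup (nodup_of_mem_trails h), List.length_map,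
    length_of_mem_trails h] at h2

/-- Walk from `i` inside `S`. The odd degree of `i` provides a first hyperedge. At a new vertex
other than `j` the degree is even, so there is another hyperedge besides the one of arrival. It is
unused, for otherwise the vertex would have been met before. A walk that never reaches `j` nor
closes could go on forever, although hyperedges are not repeated and `S` is finite. -/
lemma exists_trail_of_hasOddBoundary {S : Finset (Hyperedge N Δ)} {i j : Fin N}
    (hS : HasOddBoundary S i j) :
    ∃ n, ∃ l ∈ trails i n, (∀ a ∈ l, a.1 ∈ S) ∧ (trailEnd i l = j ∨ trailCloses i l) := by
  classical
  by_contra! hcon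
  have key : ∀ n, ∃ l ∈ trails i n, ∀ a ∈ l, a.1 ∈ S := by
    intro n
    induction n with
    | zero => exact ⟨[], by simp [trails], by simp⟩
    | succ n ih =>
      obtain ⟨l, hl, hlS⟩ := ih
      obtain ⟨hj, hc⟩ := hcon n l hl hlS
      obtain ⟨e, heS, hve, hel⟩ : ∃ e ∈ S, trailEnd i l ∈ e.1 ∧ e ∉ l.map Prod.fst := by
        cases l with
        | nil =>
          obtain ⟨e, he⟩ := Finset.card_pos.1 ((hS i).2 (Or.inl rfl)).pos
          rw [Finset.mem_filter] at he
          exact ⟨e, he.1, he.2, by simp⟩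
        | cons a l' =>
          simp only [trailEnd] at hj ⊢
          simp only [trailCloses] at hc
          have hi : a.2 ≠ i := fun h => hc (by rw [h]; exact Finset.mem_insert_self _ _)
          have heven : Even (S.filter fun e => a.2 ∈ e.1).card := by
            rw [← Nat.not_odd_iff_even, hS]
            tauto
          have ha : a.1 ∈ S.filter fun e => a.2 ∈ e.1 := by
            rw [Finset.mem_filter]
            refine ⟨hlS a (by simp), ?_⟩
            cases n with
            | zero => simp [trails] at hl
            | succ n =>
              obtain ⟨b, l'', hb, -, hstep⟩ := mem_trails_succ.1 hl
              simp only [List.cons.injEq] at hb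
              rw [hb.1]
              exact hstep.2.2.1
          have h1 : 1 < (S.filter fun e => a.2 ∈ e.1).card := by
            have := Finset.card_pos.2 ⟨_, ha⟩
            obtain ⟨m, hm⟩ := heven
            omega
          obtain ⟨e, he, hne⟩ := Finset.exists_mem_ne h1 a.1
          rw [Finset.mem_filter] at he
          refine ⟨e, he.1, he.2, ?_⟩
          rw [List.map_cons, List.mem_cons]
          rintro (h | h)
          · exact hne h
          · obtain ⟨b, hb, rfl⟩ := List.mem_map.1 h
            exact hc (Finset.mem_insert_of_mem (Finset.mem_biUnion.2
              ⟨b, List.mem_toFinset.2 hb, he.2⟩))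
      obtain ⟨w, hw, hwne⟩ := Finset.exists_mem_ne (s := e.1) (by have := e.2.1; omega)
        (trailEnd i l)
      refine ⟨(e, w) :: l, mem_trails_succ.2 ⟨_, _, rfl, hl, hel, hve, hw, hwne⟩, ?_⟩
      intro a ha
      rcases List.mem_cons.1 ha with rfl | ha
      · exact heS
      · exact hlS a ha
  obtain ⟨l, hl, hlS⟩ := key (S.card + 1)
  have := card_ge_of_mem_trails hl hlS
  omega

lemma HasShortBoundary.exists_trail {X : Hyperedge N Δ → Bool} {k : ℕ} {i j : Fin N}
    (h : HasShortBoundary X k i j) :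
    ∃ n < k, ∃ l ∈ trails i n, (∀ a ∈ l, X a.1 = true) ∧ (trailEnd i l = j ∨ trailCloses i l) := by
  obtain ⟨S, hX, hS, hk⟩ := h
  obtain ⟨n, l, hl, hlS, h⟩ := exists_trail_of_hasOddBoundary hS
  exact ⟨n, (card_ge_of_mem_trails hl hlS).trans_lt hk, l, hl, fun a ha => hX _ (hlS a ha), h⟩

end Trails

/-! ### Expected number of trails -/

section Expectation

variable {N Δ : ℕ} {α : ℕ → ℝ}

lemma edgeProb_le (hα : ∀ p, 2 ≤ p → p ≤ Δ → 0 ≤ α p) (e : Hyperedge N Δ) :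
    (edgeProb α N e.1.card : ℝ) ≤ α e.1.card * N / N.choose e.1.card := by
  have h0 := hα _ e.2.1 e.2.2
  simp only [edgeProb, toUnit, Set.coe_projIcc]
  exact max_le (by positivity) (min_le_right _ _)

lemma card_hyperedges_containing_le (v w : Fin N) (hvw : v ≠ w) (p : ℕ) :
    ((Finset.univ : Finset (Hyperedge N Δ)).filter
      fun e => (v ∈ e.1 ∧ w ∈ e.1) ∧ e.1.card = p).card ≤ (N - 2).choose (p - 2) := by
  have hcard : (((Finset.univ : Finset (Fin N)).erase v).erase w).card = N - 2 := by
    rw [Finset.card_erase_of_mem (by simp [hvw.symm]), Finset.card_erase_of_mem (by simp)]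
    simp only [Finset.card_univ, Fintype.card_fin]
    omega
  rw [← hcard, ← Finset.card_powersetCard]
  refine Finset.card_le_card_of_injOn (fun e => (e.1.erase v).erase w) ?_ ?_
  · intro e he
    simp only [Finset.coe_filter, Finset.mem_univ, true_and, Set.mem_ofPred_eq] at he
    rw [Finset.mem_coe, Finset.mem_powersetCard]
    refine ⟨Finset.erase_subset_erase _ (Finset.erase_subset_erase _ (Finset.subset_univ _)), ?_⟩
    rw [Finset.card_erase_of_mem (by simp [hvw.symm, he.1.2]), Finset.card_erase_of_mem he.1.1]
    omega
  · intro e he e' he' h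
    simp only [Finset.coe_filter, Finset.mem_univ, true_and, Set.mem_ofPred_eq] at he he'
    have h1 : ∀ e : Finset (Fin N), v ∈ e → w ∈ e → insert v (insert w ((e.erase v).erase w)) = e := by
      intro e h1 h2
      rw [Finset.insert_erase (by simp [hvw.symm, h2]), Finset.insert_erase h1]
    apply Subtype.ext
    simp only at h
    rw [← h1 e.1 he.1.1 he.1.2, h, h1 e'.1 he'.1.1 he'.1.2]

lemma choose_mul_pair (n q : ℕ) : (n + 2).choose (q + 2) * ((q + 2) * (q + 1)) =
    (n + 2) * (n + 1) * n.choose q := by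
  have h1 := Nat.add_one_mul_choose_eq (n + 1) (q + 1)
  have h2 := Nat.add_one_mul_choose_eq n q
  calc (n + 2).choose (q + 2) * ((q + 2) * (q + 1))
      = ((n + 1 + 1).choose (q + 1 + 1) * (q + 1 + 1)) * (q + 1) := by ring
    _ = (n + 2) * ((n + 1).choose (q + 1) * (q + 1)) := by rw [← h1]; ring
    _ = _ := by rw [← h2]; ring

open Classical in
-- At most `C(N-2, p-2)` hyperedges of size `p` contain two given vertices, and `C(N-2, p-2) / C(N,
-- p) = p (p - 1) / (N (N - 1))` for `p ≤ N`. This is where `λ` comes from.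
lemma sum_edgeProb_containing_le (hα : ∀ p, 2 ≤ p → p ≤ Δ → 0 ≤ α p) (v w : Fin N) (hvw : v ≠ w) :
    ∑ e : Hyperedge N Δ, (if v ∈ e.1 ∧ w ∈ e.1 then (edgeProb α N e.1.card : ℝ) else 0) ≤
      branching Δ α / (N - 1) := by
  rw [← Finset.sum_filter, branching, Finset.sum_div]
  rw [← Finset.sum_fiberwise_of_maps_to (t := Finset.Icc 2 Δ) (g := fun e : Hyperedge N Δ => e.1.card)
    (fun e _ => Finset.mem_Icc.2 e.2)]
  refine Finset.sum_le_sum fun p hp => ?_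
  obtain ⟨hp2, hpΔ⟩ := Finset.mem_Icc.1 hp
  rw [Finset.filter_filter]
  have hα0 := hα p hp2 hpΔ
  have hN : 2 ≤ N := by
    have := v.2; have := w.2; have : (v : ℕ) ≠ w := fun h => hvw (Fin.ext h)
    omega
  refine (Finset.sum_le_card_nsmul _ _ (α p * N / N.choose p) fun e he => ?_).trans ?_
  · have : e.1.card = p := (Finset.mem_filter.1 he).2.2
    rw [← this]; exact edgeProb_le hα e
  · rw [nsmul_eq_mul]
    have hc : (((Finset.univ : Finset (Hyperedge N Δ)).filter
      fun e => (v ∈ e.1 ∧ w ∈ e.1) ∧ e.1.card = p).card : ℝ) ≤ ((N - 2).choose (p - 2) : ℝ) := by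
      exact_mod_cast card_hyperedges_containing_le v w hvw p
    refine (mul_le_mul_of_nonneg_right hc (by positivity)).trans ?_
    obtain ⟨n, rfl⟩ := Nat.exists_eq_add_of_le' hN
    obtain ⟨q, rfl⟩ := Nat.exists_eq_add_of_le' hp2
    have h := choose_mul_pair n q
    have h' : ((n + 2).choose (q + 2) : ℝ) * (((q : ℝ) + 2) * (q + 1)) =
      ((n : ℝ) + 2) * (n + 1) * (n.choose q : ℝ) := by exact_mod_cast h
    simp only [Nat.add_sub_cancel]
    push_cast
    have e1 : ((q : ℝ) + 2 - 1) = q + 1 := by ring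
    have e2 : ((n : ℝ) + 2 - 1) = n + 1 := by ring
    rw [e1, e2]
    -- If the size exceeds `N`, the binomial is 0 and division by it gives 0.
    rcases Nat.eq_zero_or_pos ((n + 2).choose (q + 2)) with h0 | h0
    · rw [h0]; simp; positivity
    · have h0' : (0 : ℝ) < ((n + 2).choose (q + 2) : ℝ) := by exact_mod_cast h0
      rw [mul_div_assoc', div_le_div_iff₀ h0' (by positivity)]
      refine le_of_eq ?_
      linear_combination (-α (q + 2)) * h'

/-- The probability that the hyperedges of a trail are all present. -/
def trailWeight (α : ℕ → ℝ) (l : List (Hyperedge N Δ × Fin N)) : ℝ :=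
  (l.map fun a => (edgeProb α N a.1.1.card : ℝ)).prod

lemma trailWeight_nonneg (l : List (Hyperedge N Δ × Fin N)) : 0 ≤ trailWeight α l :=
  List.prod_nonneg fun x hx => by
    obtain ⟨a, -, rfl⟩ := List.mem_map.1 hx
    exact (edgeProb α N a.1.1.card).2.1

lemma trailWeight_cons (a : Hyperedge N Δ × Fin N) (l : List (Hyperedge N Δ × Fin N)) :
    trailWeight α (a :: l) = edgeProb α N a.1.1.card * trailWeight α l := by
  simp [trailWeight]

lemma branching_nonneg (hα : ∀ p, 2 ≤ p → p ≤ Δ → 0 ≤ α p) : 0 ≤ branching Δ α :=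
  Finset.sum_nonneg fun p hp => by
    obtain ⟨h2, hΔ⟩ := Finset.mem_Icc.1 hp
    have h2' : (2 : ℝ) ≤ p := by exact_mod_cast h2
    exact mul_nonneg (mul_nonneg (by linarith) (by linarith)) (hα p h2 hΔ)

open Classical in
/-- Extending a trail by one step to a vertex in `A` costs at most `|A| λ / (N - 1)`. -/
lemma sum_step_le (hα : ∀ p, 2 ≤ p → p ≤ Δ → 0 ≤ α p) (v : Fin N) (A : Finset (Fin N))
    (hA : v ∉ A) {x : ℝ} (hx : 0 ≤ x) {P : Hyperedge N Δ → Fin N → Prop}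
    (hP : ∀ e w, P e w → v ∈ e.1 ∧ w ∈ e.1 ∧ w ∈ A) :
    ∑ e : Hyperedge N Δ, ∑ w, (if P e w then (edgeProb α N e.1.card : ℝ) * x else 0) ≤
      A.card * (branching Δ α / (N - 1)) * x := by
  calc ∑ e : Hyperedge N Δ, ∑ w, (if P e w then (edgeProb α N e.1.card : ℝ) * x else 0)
      ≤ ∑ e : Hyperedge N Δ, ∑ w, (if w ∈ A then
          (if v ∈ e.1 ∧ w ∈ e.1 then (edgeProb α N e.1.card : ℝ) else 0) * x else 0) := by
        refine Finset.sum_le_sum fun e _ => Finset.sum_le_sum fun w _ => ?_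
        have h0 := (edgeProb α N e.1.card).2.1
        by_cases h : P e w
        · obtain ⟨h1, h2, h3⟩ := hP e w h
          simp [h, h1, h2, h3]
        · rw [if_neg h]
          split_ifs <;> positivity
    _ = ∑ w ∈ A, (∑ e : Hyperedge N Δ,
          (if v ∈ e.1 ∧ w ∈ e.1 then (edgeProb α N e.1.card : ℝ) else 0)) * x := by
        simp_rw [Finset.sum_ite_mem, Finset.univ_inter, Finset.sum_mul]
        exact Finset.sum_comm
    _ ≤ ∑ w ∈ A, (branching Δ α / (N - 1)) * x := by
        refine Finset.sum_le_sum fun w hw => mul_le_mul_of_nonneg_right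
          (sum_edgeProb_containing_le hα v w ?_) hx
        rintro rfl; exact hA hw
    _ = _ := by rw [Finset.sum_const, nsmul_eq_mul, mul_assoc]

open Classical in
-- Each step has `N - 1` possible endpoints, each costing `λ / (N - 1)`: the growth of a branching
-- process with mean offspring `λ`.
lemma sum_trailWeight_le (hα : ∀ p, 2 ≤ p → p ≤ Δ → 0 ≤ α p) (i : Fin N) (n : ℕ) :
    ∑ l ∈ trails (Δ := Δ) i n, trailWeight α l ≤ branching Δ α ^ n := by
  induction n with
  | zero => simp [trails, trailWeight]
  | succ n ih =>
    rw [sum_trails_succ, pow_succ']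
    refine le_trans ?_ (mul_le_mul_of_nonneg_left ih (branching_nonneg hα))
    rw [Finset.mul_sum]
    refine Finset.sum_le_sum fun l _ => ?_
    simp only [trailWeight_cons]
    refine (sum_step_le hα (trailEnd i l) (Finset.univ.erase (trailEnd i l)) (by simp)
      (trailWeight_nonneg l) fun e w h => ⟨h.2.1, h.2.2.1, by simpa using h.2.2.2⟩).trans ?_
    refine mul_le_mul_of_nonneg_right ?_ (trailWeight_nonneg l)
    rw [Finset.card_erase_of_mem (Finset.mem_univ _), Finset.card_univ, Fintype.card_fin,
      Nat.cast_sub i.pos, Nat.cast_one]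
    -- For `N = 1` no step is possible, and the bound reads `0 ≤ λ`.
    rcases eq_or_ne ((N : ℝ) - 1) 0 with h | h
    · rw [h]; simp [branching_nonneg hα]
    · rw [mul_div_cancel₀ _ h]

open Classical in
-- Only the last step changes: its endpoint must lie among the boundedly many vertices met so far
-- instead of being any of the `N - 1` others.
lemma sum_closing_trailWeight_le (hα : ∀ p, 2 ≤ p → p ≤ Δ → 0 ≤ α p) (i : Fin N) (n : ℕ) :
    ∑ l ∈ trails (Δ := Δ) i n, (if trailCloses i l then trailWeight α l else 0) ≤
      (1 + n * Δ) * branching Δ α ^ n / (N - 1) := by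
  have hN : (0 : ℝ) ≤ (N : ℝ) - 1 := by
    have : (1 : ℝ) ≤ N := by exact_mod_cast i.pos
    linarith
  have hb := branching_nonneg hα
  cases n with
  | zero => simp [trails, trailCloses, hN]
  | succ n =>
    rw [sum_trails_succ]
    have h : ∀ l ∈ trails (Δ := Δ) i n, ∑ e : Hyperedge N Δ, ∑ w, (if IsStep i l (e, w) then
        (if trailCloses i ((e, w) :: l) then trailWeight α ((e, w) :: l) else 0) else 0) ≤
        ((1 + (n + 1 : ℕ) * Δ) * (branching Δ α / (N - 1))) * trailWeight α l := by
      intro l hl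
      refine (le_of_eq (Finset.sum_congr rfl fun e _ => Finset.sum_congr rfl fun w _ => ?_)).trans
        ((sum_step_le hα (trailEnd i l) ((trailSupport i l).erase (trailEnd i l)) (by simp)
        (trailWeight_nonneg (α := α) l) (P := fun e w => IsStep i l (e, w) ∧ w ∈ trailSupport i l)
        fun e w h => ⟨h.1.2.1, h.1.2.2.1, Finset.mem_erase.2 ⟨h.1.2.2.2, h.2⟩⟩).trans ?_)
      · by_cases h1 : IsStep i l (e, w) <;> by_cases h2 : w ∈ trailSupport i l <;>
          simp [h1, h2, trailCloses, trailWeight_cons]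
      refine mul_le_mul_of_nonneg_right (mul_le_mul_of_nonneg_right ?_ (by positivity))
        (trailWeight_nonneg l)
      have h1 := (Finset.card_erase_le (a := trailEnd i l)).trans (card_trailSupport_le i l)
      rw [length_of_mem_trails hl] at h1
      have h2 : (((trailSupport i l).erase (trailEnd i l)).card : ℝ) ≤ 1 + n * Δ := by
        exact_mod_cast h1
      push_cast
      nlinarith [Nat.cast_nonneg (α := ℝ) Δ]
    refine (Finset.sum_le_sum h).trans ?_
    rw [← Finset.mul_sum]
    refine (mul_le_mul_of_nonneg_left (sum_trailWeight_le hα i n) (by positivity)).trans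
      (le_of_eq ?_)
    rw [pow_succ]
    ring

/-- The law of the random hypergraph. -/
def edgeLaw (N Δ : ℕ) (α : ℕ → ℝ) : Measure (Hyperedge N Δ → Bool) :=
  Measure.pi fun e : Hyperedge N Δ => bernoulliMeasure true false (edgeProb α N e.1.card)

instance : IsProbabilityMeasure (edgeLaw N Δ α) := by unfold edgeLaw; infer_instance

/-- A trail repeats no hyperedge, so independence gives a product with one factor per step. -/
lemma edgeLaw_trail {i : Fin N} {n : ℕ} {l : List (Hyperedge N Δ × Fin N)} (hl : l ∈ trails i n) :
    (edgeLaw N Δ α).real {X | ∀ a ∈ l, X a.1 = true} = trailWeight α l := by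
  classical
  have hset : {X : Hyperedge N Δ → Bool | ∀ a ∈ l, X a.1 = true} =
      Set.univ.pi fun e => if e ∈ (l.map Prod.fst).toFinset then {true} else Set.univ := by
    ext X
    simp only [Set.mem_ofPred_eq, Set.mem_pi, Set.mem_univ, true_implies, List.mem_toFinset]
    constructor
    · intro h e
      split_ifs with he
      · obtain ⟨a, ha, rfl⟩ := List.mem_map.1 he
        exact h a ha
      · trivial
    · intro h a ha
      have := h a.1
      rw [if_pos (List.mem_map_of_mem ha)] at this
      exact this
  rw [hset, measureReal_def, edgeLaw, Measure.pi_pi, ENNReal.toReal_prod]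
  have h : ∀ e : Hyperedge N Δ, (bernoulliMeasure true false (edgeProb α N e.1.card)
      (if e ∈ (l.map Prod.fst).toFinset then {true} else Set.univ)).toReal =
        if e ∈ (l.map Prod.fst).toFinset then (edgeProb α N e.1.card : ℝ) else 1 := by
    intro e
    split_ifs
    · rw [← measureReal_def, bernoulliMeasure_real_apply_of_mem_of_notMem] <;> simp
    · simp
  simp_rw [h]
  rw [Finset.prod_ite_mem, Finset.univ_inter, List.prod_toFinset _ (nodup_of_mem_trails hl),
    trailWeight, List.map_map]
  rfl

open Classical in
lemma indicator_hasShortBoundary_le (X : Hyperedge N Δ → Bool) (k : ℕ) (i j : Fin N) :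
    (if HasShortBoundary X k i j then (1 : ℝ) else 0) ≤
      ∑ n ∈ Finset.range k, ∑ l ∈ trails i n, (if ∀ a ∈ l, X a.1 = true then (1 : ℝ) else 0) *
        ((if trailEnd i l = j then 1 else 0) + if trailCloses i l then 1 else 0) := by
  have h0 : ∀ l : List (Hyperedge N Δ × Fin N), (0 : ℝ) ≤ (if ∀ a ∈ l, X a.1 = true then (1 : ℝ) else 0) *
        ((if trailEnd i l = j then 1 else 0) + if trailCloses i l then 1 else 0) := by
    intro l
    split_ifs <;> norm_num
  split_ifs with h
  · obtain ⟨n, hn, l, hl, hX, h⟩ := h.exists_trail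
    refine le_trans ?_ (Finset.single_le_sum
      (f := fun n => ∑ l ∈ trails i n, (if ∀ a ∈ l, X a.1 = true then (1 : ℝ) else 0) *
        ((if trailEnd i l = j then 1 else 0) + if trailCloses i l then 1 else 0))
      (fun n _ => Finset.sum_nonneg fun l _ => h0 l) (Finset.mem_range.2 hn))
    refine le_trans ?_ (Finset.single_le_sum (fun l _ => h0 l) hl)
    rw [if_pos hX, one_mul]
    rcases h with h | h
    · rw [if_pos h]; split_ifs <;> norm_num
    · rw [if_pos h]; split_ifs <;> norm_num
  · exact Finset.sum_nonneg fun n _ => Finset.sum_nonneg fun l _ => h0 l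

open Classical in
/-- The expected number of vertices joined to `i` by a short boundary. -/
theorem sum_integral_hasShortBoundary_le (hα : ∀ p, 2 ≤ p → p ≤ Δ → 0 ≤ α p) (k : ℕ) (i : Fin N) :
    ∑ j, ∫ X, (if HasShortBoundary X k i j then (1 : ℝ) else 0) ∂(edgeLaw N Δ α) ≤
      ∑ n ∈ Finset.range k, (3 + 2 * n * Δ) * branching Δ α ^ n := by
  have hint : ∀ f : (Hyperedge N Δ → Bool) → ℝ, Integrable f (edgeLaw N Δ α) :=
    fun f => Integrable.of_finite
  have hb := branching_nonneg hα
  calc ∑ j, ∫ X, (if HasShortBoundary X k i j then (1 : ℝ) else 0) ∂(edgeLaw N Δ α)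
      ≤ ∑ j, ∑ n ∈ Finset.range k, ∑ l ∈ trails i n, trailWeight α l *
        ((if trailEnd i l = j then 1 else 0) + if trailCloses i l then 1 else 0) := by
        refine Finset.sum_le_sum fun j _ => ?_
        refine (integral_mono (hint _) (hint _)
          fun X => indicator_hasShortBoundary_le X k i j).trans (le_of_eq ?_)
        rw [integral_finsetSum _ fun n _ => hint _]
        refine Finset.sum_congr rfl fun n _ => ?_
        rw [integral_finsetSum _ fun l _ => hint _]
        refine Finset.sum_congr rfl fun l hl => ?_
        rw [integral_mul_const, ← edgeLaw_trail hl]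
        congr 1
        rw [← integral_indicator_one (Set.toFinite _).measurableSet]
        refine integral_congr_ae (Filter.Eventually.of_forall fun X => ?_)
        simp [Set.indicator_apply]
    -- A trail ends at a single `j`, but a closing trail is charged to every `j`; hence the weight
    -- `N`.
    _ = ∑ n ∈ Finset.range k, ∑ l ∈ trails i n, trailWeight α l *
        (1 + if trailCloses i l then (N : ℝ) else 0) := by
        rw [Finset.sum_comm]
        refine Finset.sum_congr rfl fun n _ => ?_
        rw [Finset.sum_comm]
        refine Finset.sum_congr rfl fun l _ => ?_
        rw [← Finset.mul_sum, Finset.sum_add_distrib]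
        simp
    _ ≤ ∑ n ∈ Finset.range k, (3 + 2 * n * Δ) * branching Δ α ^ n := by
        refine Finset.sum_le_sum fun n _ => ?_
        have h1 : ∑ l ∈ trails (Δ := Δ) i n, trailWeight α l *
            (1 + if trailCloses i l then (N : ℝ) else 0) =
            ∑ l ∈ trails (Δ := Δ) i n, trailWeight α l +
            N * ∑ l ∈ trails (Δ := Δ) i n, (if trailCloses i l then trailWeight α l else 0) := by
          rw [Finset.mul_sum, ← Finset.sum_add_distrib]
          refine Finset.sum_congr rfl fun l _ => ?_
          split_ifs <;> ring
        rw [h1]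
        have h2 := sum_trailWeight_le hα i n
        have h3 := mul_le_mul_of_nonneg_left (sum_closing_trailWeight_le hα i n)
          (Nat.cast_nonneg (α := ℝ) N)
        -- For `N = 1` the quotient is 0 by convention. This bound gives `1 + 2 (1 + n Δ) = 3 + 2 n
        -- Δ`.
        have h4 : (N : ℝ) / (N - 1) ≤ 2 := by
          have h5 : 1 ≤ N := i.pos
          rcases h5.eq_or_lt with h6 | h6
          · rw [← h6]; norm_num
          · have : (2 : ℝ) ≤ N := by exact_mod_cast h6
            rw [div_le_iff₀ (by linarith)]
            linarith
        have h5 : (N : ℝ) * ((1 + n * Δ) * branching Δ α ^ n / (N - 1)) ≤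
            2 * ((1 + n * Δ) * branching Δ α ^ n) := by
          rw [← mul_div_assoc, mul_div_right_comm]
          exact mul_le_mul_of_nonneg_right h4 (by positivity)
        refine (add_le_add h2 (h3.trans h5)).trans (le_of_eq ?_)
        ring

end Expectation

/-! ### Conclusion -/

section Conclusion

variable {N Δ : ℕ} {α : ℕ → ℝ} {ρ : ℕ → ℝ → ℝ}

instance (t : ℝ) (κ : Perturbation) : IsProbabilityMeasure (law N Δ α t κ) := by
  unfold law; infer_instance

lemma integrable_overlapSqAvg
    (hρ : ∀ p, 2 ≤ p → p ≤ Δ → Function.Odd (ρ p) ∧ Measurable (ρ p)) (κ : Perturbation) (t : ℝ)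
    (β : ℝ≥0∞) : Integrable (overlapSqAvg ρ β) (law N Δ α t κ) :=
  integrable_of_abs_le (measurable_overlapSqAvg hρ β) (abs_overlapSqAvg_le β)

/-- One factor `b ^ k` is the geometric series. The other absorbs the linear factor, by Bernoulli's
inequality `k ≤ b ^ k / (b - 1)`; this is the source of the 2 in `2 log λ`. -/
lemma sum_range_trail_le {b : ℝ} (hb : 1 < b) (k : ℕ) :
    ∑ n ∈ Finset.range k, (3 + 2 * n * Δ) * b ^ n ≤
      (3 + 2 * Δ / (b - 1)) / (b - 1) * b ^ (2 * k) := by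
  have hb0 : 0 < b - 1 := by linarith
  have hk : (k : ℝ) ≤ b ^ k / (b - 1) := by
    rw [le_div_iff₀ hb0]
    have := one_add_mul_le_pow (a := b - 1) (by linarith) k
    rw [add_sub_cancel] at this
    linarith
  have h1k : 1 ≤ b ^ k := one_le_pow₀ hb.le
  have hΔ : (0 : ℝ) ≤ Δ := Nat.cast_nonneg _
  calc ∑ n ∈ Finset.range k, (3 + 2 * n * Δ) * b ^ n
      ≤ ∑ n ∈ Finset.range k, (3 + 2 * k * Δ) * b ^ n := by
        refine Finset.sum_le_sum fun n hn => ?_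
        have : (n : ℝ) ≤ k := by exact_mod_cast (Finset.mem_range.1 hn).le
        gcongr
    _ = (3 + 2 * k * Δ) * ((b ^ k - 1) / (b - 1)) := by
        rw [← Finset.mul_sum, geom_sum_eq (by linarith)]
    _ ≤ ((3 + 2 * Δ / (b - 1)) * b ^ k) * (b ^ k / (b - 1)) := by
        have h2 : 2 * (k : ℝ) * Δ ≤ 2 * (b ^ k / (b - 1)) * Δ := by gcongr
        have h3 : 3 + 2 * (k : ℝ) * Δ ≤ (3 + 2 * Δ / (b - 1)) * b ^ k := by
          have : (3 + 2 * Δ / (b - 1)) * b ^ k = 3 * b ^ k + 2 * (b ^ k / (b - 1)) * Δ := by ring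
          rw [this]; linarith
        have h4 : (b ^ k - 1) / (b - 1) ≤ b ^ k / (b - 1) := by gcongr; linarith
        exact mul_le_mul h3 h4 (div_nonneg (by linarith) hb0.le) (by positivity)
    _ = _ := by rw [pow_mul']; ring

open Classical in
theorem integral_overlapSqAvg_law_le (hα : ∀ p, 2 ≤ p → p ≤ Δ → 0 ≤ α p)
    (hlam : 1 < branching Δ α) (hN : 1 ≤ N)
    (hρ : ∀ p, 2 ≤ p → p ≤ Δ → Function.Odd (ρ p) ∧ Measurable (ρ p)) (κ : Perturbation)
    {t : ℝ} (ht : 0 ≤ t) (β : ℝ≥0∞) (k : ℕ) :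
    ∫ ω, overlapSqAvg ρ β ω ∂(law N Δ α t κ) ≤ Real.exp (-t) ^ k +
      (1 + (3 + 2 * Δ / (branching Δ α - 1)) / (branching Δ α - 1)) *
        branching Δ α ^ (2 * k) / N := by
  have hN0 : (0 : ℝ) < N := by exact_mod_cast hN
  set b := branching Δ α with hb
  set D := (3 + 2 * Δ / (b - 1)) / (b - 1)
  set c := Real.exp (-t)
  have hint : ∀ f : (Hyperedge N Δ → Bool) → ℝ, Integrable f (edgeLaw N Δ α) :=
    fun f => Integrable.of_finite
  have h1 : ∫ ω, overlapSqAvg ρ β ω ∂(law N Δ α t κ) ≤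
      ∫ X, (1 / (N : ℝ)) ^ 2 * ∑ i, ∑ j, ((if i = j then 1 else 0) +
        (if i ≠ j ∧ HasShortBoundary X k i j then 1 else 0) + c ^ k) ∂(edgeLaw N Δ α) := by
    have h := integral_prod _ (integrable_overlapSqAvg (N := N) (α := α) hρ κ t β)
    refine (le_of_eq h).trans ?_
    exact integral_mono (hint _) (hint _) fun X => integral_overlapSqAvg_le hρ κ ht β k X
  refine h1.trans ?_
  rw [integral_const_mul, integral_finsetSum _ fun i _ => hint _]
  have h2 : ∀ i : Fin N, ∫ X, ∑ j, ((if i = j then (1 : ℝ) else 0) +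
      (if i ≠ j ∧ HasShortBoundary X k i j then 1 else 0) + c ^ k) ∂(edgeLaw N Δ α) ≤
      1 + D * b ^ (2 * k) + N * c ^ k := by
    intro i
    calc ∫ X, ∑ j, ((if i = j then (1 : ℝ) else 0) +
          (if i ≠ j ∧ HasShortBoundary X k i j then 1 else 0) + c ^ k) ∂(edgeLaw N Δ α)
        ≤ ∫ X, ((1 + N * c ^ k) + ∑ j, if HasShortBoundary X k i j then (1 : ℝ) else 0)
          ∂(edgeLaw N Δ α) := by
          refine integral_mono (hint _) (hint _) fun X => ?_
          simp only [Finset.sum_add_distrib, Finset.sum_const, Finset.card_univ, Fintype.card_fin,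
            nsmul_eq_mul, Finset.sum_ite_eq, Finset.mem_univ, if_true]
          have : ∑ j, (if i ≠ j ∧ HasShortBoundary X k i j then (1 : ℝ) else 0) ≤
              ∑ j, if HasShortBoundary X k i j then (1 : ℝ) else 0 := by
            refine Finset.sum_le_sum fun j _ => ?_
            by_cases h : HasShortBoundary X k i j
            · simp only [h, and_true, if_true]; split_ifs <;> norm_num
            · simp [h]
          linarith
      _ = 1 + N * c ^ k + ∑ j, ∫ X, (if HasShortBoundary X k i j then (1 : ℝ) else 0)
          ∂(edgeLaw N Δ α) := by
          rw [integral_add (hint _) (hint _), integral_finsetSum _ fun j _ => hint _]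
          simp
      _ ≤ _ := by
          have := (sum_integral_hasShortBoundary_le hα k i).trans (sum_range_trail_le hlam k)
          linarith
  refine (mul_le_mul_of_nonneg_left (Finset.sum_le_sum fun i _ => h2 i) (by positivity)).trans ?_
  rw [Finset.sum_const, Finset.card_univ, Fintype.card_fin, nsmul_eq_mul]
  have h3 : (1 / (N : ℝ)) ^ 2 * (N * (1 + D * b ^ (2 * k) + N * c ^ k)) =
      c ^ k + (1 + D * b ^ (2 * k)) / N := by field_simp; ring
  rw [h3]
  -- The pairs with `i = j` contribute `1 / N`, which is absorbed into the term `b ^ (2 * k) / N`.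
  have h4 : 1 ≤ b ^ (2 * k) := one_le_pow₀ hlam.le
  have h5 : (1 + D * b ^ (2 * k)) / N ≤ (1 + D) * b ^ (2 * k) / N := by
    gcongr; linarith
  linarith

/-- Balancing `e^{-tk}` against `b^{2k} / N`. -/
lemma exists_balanced_exponent {b D t : ℝ} (hb : 1 < b) (hD : 0 ≤ D) (ht : 0 ≤ t) (hN : 1 ≤ N) :
    ∃ k : ℕ, Real.exp (-t) ^ k + D * b ^ (2 * k) / N ≤
      (1 + D * b ^ 2) / (N : ℝ) ^ (t / (t + 2 * Real.log b)) := by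
  have hN0 : (0 : ℝ) < N := by exact_mod_cast hN
  have hb0 : 0 < b := by linarith
  have hL : 0 < Real.log b := Real.log_pos hb
  set L := Real.log b with hLdef
  have hlogN : 0 ≤ Real.log N := Real.log_nonneg (by exact_mod_cast hN)
  have hs : 0 < t + 2 * L := by linarith
  -- At this real exponent `e^{-tx}` and `e^{2Lx} / N` coincide.
  set x := Real.log N / (t + 2 * L) with hx
  have hx0 : 0 ≤ x := div_nonneg hlogN hs.le
  have hxs : x * (t + 2 * L) = Real.log N := div_mul_cancel₀ _ hs.ne'
  refine ⟨⌈x⌉₊, ?_⟩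
  have hle : x ≤ ⌈x⌉₊ := Nat.le_ceil x
  have hlt : (⌈x⌉₊ : ℝ) < x + 1 := Nat.ceil_lt_add_one hx0
  set k := ⌈x⌉₊
  have hpow : (N : ℝ) ^ (t / (t + 2 * L)) = Real.exp (x * t) := by
    rw [Real.rpow_def_of_pos hN0, hx]; congr 1; ring
  rw [hpow, div_eq_mul_inv _ (Real.exp _), ← Real.exp_neg, add_mul, one_mul]
  refine add_le_add ?_ ?_
  · rw [← Real.exp_nat_mul]
    refine Real.exp_le_exp.2 ?_
    nlinarith
  -- Rounding `x` up only helps the decaying term; here it costs at most `b ^ 2`.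
  · have h1 : b ^ (2 * k) ≤ b ^ 2 * Real.exp (2 * L * x) := by
      have hbL : b = Real.exp L := (Real.exp_log hb0).symm
      rw [hbL, ← Real.exp_nat_mul, ← Real.exp_nat_mul, ← Real.exp_add]
      refine Real.exp_le_exp.2 ?_
      push_cast
      nlinarith
    have h2 : Real.exp (2 * L * x) / N = Real.exp (-(x * t)) := by
      have hNe : (N : ℝ) = Real.exp (x * (t + 2 * L)) := by rw [hxs, Real.exp_log hN0]
      rw [div_eq_iff hN0.ne', hNe, ← Real.exp_add]
      congr 1; ring
    rw [← h2]
    calc D * b ^ (2 * k) / N ≤ D * (b ^ 2 * Real.exp (2 * L * x)) / N := by gcongr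
      _ = _ := by ring

end Conclusion

end

end DilutedSpin

theorem theorem2 (Δ : ℕ) (hΔ : 2 ≤ Δ) (α : ℕ → ℝ) (hα : ∀ p, 2 ≤ p → p ≤ Δ → 0 ≤ α p)
    (hlam : 1 < DilutedSpin.branching Δ α) :
    ∃ C : ℝ, 0 < C ∧
      ∀ ρ : ℕ → ℝ → ℝ, (∀ p, 2 ≤ p → p ≤ Δ → Function.Odd (ρ p) ∧ Measurable (ρ p)) →
      ∀ (κ : DilutedSpin.Perturbation) (t : ℝ), 0 ≤ t → ∀ (β : ℝ≥0∞) (N : ℕ), 1 ≤ N →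
        Integrable (DilutedSpin.overlapSqAvg ρ β) (DilutedSpin.law N Δ α t κ) ∧
        ∫ ω, DilutedSpin.overlapSqAvg ρ β ω ∂(DilutedSpin.law N Δ α t κ) ≤
          C / (N : ℝ) ^ (t / (t + 2 * Real.log (DilutedSpin.branching Δ α))) := by
  set b := DilutedSpin.branching Δ α with hb
  have hb1 : 0 < b - 1 := by linarith
  have hD : 0 ≤ 1 + (3 + 2 * Δ / (b - 1)) / (b - 1) := by positivity
  refine ⟨1 + (1 + (3 + 2 * Δ / (b - 1)) / (b - 1)) * b ^ 2, by positivity, ?_⟩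
  intro ρ hρ κ t ht β N hN
  refine ⟨DilutedSpin.integrable_overlapSqAvg hρ κ t β, ?_⟩
  obtain ⟨k, hk⟩ := DilutedSpin.exists_balanced_exponent hlam hD ht hN
  exact (DilutedSpin.integral_overlapSqAvg_law_le hα hlam hN hρ κ ht β k).trans hk
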